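/- **Setting.** Let $\mathcal C$ be a concrete monoidal $W^*$-category: a monoidal category whose Hom-spaces are complex Banach spaces with given preduals, with bilinear submultiplicative composition and conjugate-linear isometric involutions $\mathrm{Hom}(X,Y)\to\mathrm{Hom}(Y,X)$ satisfying $(fg)^*=g^*f^*$ and $\|f^*f\|=\|f\|^2$, whose tensor product is bilinear, normal in each variable and satisfies $(f\otimes g)^*=f^*\otimes g^*$, and whose coherence isomorphisms are unitary; together with a linear, normal, $*$-preserving strong monoidal functor (with unitary coherence maps) to the category of Hilbert spaces with the Hilbert space tensor product, $X\mapsto\mathcal X$ (not assumed faithful). Coherence isomorphisms and this functor are suppressed from the notation. Let $c$ be a braiding on $\mathcal C$ all of whose components $c_{X,Y}:X\otimes Y\to Y\otimes X$ are unitary. Write $[\,\cdot\,]$ for the norm-closed linear span, $B(\cdot,\cdot)_*$ for the predual of the space of bounded operators, and $K(\cdot,\cdot)$ for compact operators. A braiding $c$ (on any monoidal $*$-category with such a functor to Hilbert spaces) is *semi-regular* if it is unitary and, for all objects $X,Y$, $$K(\mathcal X,\mathcal Y)\subseteq[(\mathrm{id}\otimes\omega)(c_{X,Y})\mid\omega\in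 B(\mathcal Y,\mathcal X)_*],$$ and *regular* if it is unitary and equality always holds. **Leg notation.** On a triple tensor product put $f_{12}=f\otimes\mathrm{id}$, $f_{23}=\mathrm{id}\otimes f$. For $f:X\otimes Z\to X\otimes Z$ and a middle object $Y$ put, on $X\otimes Y\otimes Z$, $$f_{13}=(c_{X,Y}^{-1}\otimes\mathrm{id}_Z)(\mathrm{id}_Y\otimes f)(c_{X,Y}\otimes\mathrm{id}_Z),\qquad f'_{13}=(c_{Y,X}\otimes\mathrm{id}_Z)(\mathrm{id}_Y\otimes f)(c_{Y,X}^{-1}\otimes\mathrm{id}_Z).$$ **Multiplicative unitaries.** Let $L\in\mathcal C$ with $\mathcal L\neq0$ and let $F:L\otimes L\to L\otimes L$ be a multiplicative unitary: $F$ is unitary and $F_{23}F_{12}=F_{12}F_{13}F_{23}$. It is *semi-regular* if $K(\mathcal L)\subseteq[(\mathrm{id}\otimes\omega)(c_{L,L}^{-1}F)\mid\omega\in B(\mathcal L)_*]$, and *regular* if equality holds. **Yetter–Drinfeld modules.** The category ${}_F\mathcal{YD}^F(\mathcal C)$ has as objects the triples $(H,U_H,V_H)$ with $H\in\mathcal C$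 and unitary morphisms $U_H:H\otimes L\to H\otimes L$, $V_H:L\otimes H\to L\otimes H$ of $\mathcal C$ such that, with $U=U_H$, $V=V_H$, $$F_{23}U_{12}=U_{12}U_{13}F_{23},\qquad V_{23}F_{12}=F_{12}V_{13}V_{23},\qquad V_{12}F_{13}U_{23}=U_{23}F'_{13}V_{12}$$ on $H\otimes L\otimes L$, $L\otimes L\otimes H$ and $L\otimes H\otimes L$ respectively. Its morphisms are the morphisms $f:H\to K$ of $\mathcal C$ with $U_K(f\otimes\mathrm{id})=(f\otimes\mathrm{id})U_H$ and $V_K(\mathrm{id}\otimes f)=(\mathrm{id}\otimes f)V_H$. It is a monoidal $*$-category with the involution, coherence isomorphisms and underlying Hilbert spaces of $\mathcal C$, with $U_{H\otimes K}=(U_H)_{13}(U_K)_{23}$, $V_{H\otimes K}=(V_K)'_{13}(V_H)_{12}$, and trivial structure on the unit object. For objects $H,K$ of ${}_F\mathcal{YD}^F(\mathcal C)$ the operator $V_K*U_H$ on $\mathcal H\otimes\mathcal K$ is defined by $$(V_K*U_H)_{13}=(U_H)_{12}^*\,(V_K)_{23}\,(U_H)_{12}\,(V_K)_{23}^*\quad\text{on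 }H\otimes L\otimes K,$$ where, for a bounded operator $T$ on $\mathcal H\otimes\mathcal K$, $T_{13}=(\mathrm{id}\otimes c_{K,L})(T\otimes\mathrm{id}_{\mathcal L})(\mathrm{id}\otimes c_{K,L}^{-1})$; for a morphism $T$ of $\mathcal C$ this is the leg notation above. **Statement.** Suppose that $c$ and $F$ are both semi-regular (respectively, both regular). Then: 1. For all $H,K\in{}_F\mathcal{YD}^F(\mathcal C)$ there is exactly one bounded operator $V_K*U_H$ on $\mathcal H\otimes\mathcal K$ as above; it is unitary, and $\Phi_{H,K}=c_{K,H}^{-1}\circ(V_K*U_H)$ satisfies $$K(\mathcal H,\mathcal K)\subseteq[(\mathrm{id}\otimes\omega)(\Phi_{H,K})\mid\omega\in B(\mathcal K,\mathcal H)_*]\qquad(\text{respectively, with equality}).$$ 2. If the functor to Hilbert spaces is faithful and every operator $V_K*U_H$ is the image of a morphism of $\mathcal C$, then there is exactly one braiding $\Phi$ on ${}_F\mathcal{YD}^F(\mathcal C)$ such that, for all $H,K$, $\Phi_{H,K}=c_{K,H}^{-1}\circ W$ for a unitary morphism $W:H\otimes K\to H\otimes K$ of $\mathcal C$ with $W_{13}=(U_H)_{12}^*(V_K)_{23}(U_H)_{12}(V_K)_{23}^*$.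 3. Every braiding $\Phi$ on ${}_F\mathcal{YD}^F(\mathcal C)$ of the form described in 2 is semi-regular (respectively, regular). -/

import Mathlib

universe w v u

open CategoryTheory MonoidalCategory

open scoped InnerProductSpace

namespace BraidedMU

noncomputable section

/-! ### `W*`-categories -/

/-- A category with an involution `Hom(X,Y) → Hom(Y,X)`. -/
class StarCategory (C : Type u) [Category.{v} C] where
  adj {X Y : C} (f : X ⟶ Y) : Y ⟶ X
  adj_adj {X Y : C} (f : X ⟶ Y) : adj (adj f) = f
  adj_comp {X Y Z : C} (f : X ⟶ Y) (g : Y ⟶ Z) : adj (f ≫ g) = adj g ≫ adj f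

/-- Unitary morphisms. -/
structure IsUnitary {C : Type u} [Category.{v} C] [StarCategory C] {X Y : C} (f : X ⟶ Y) :
    Prop where
  comp_adj : f ≫ StarCategory.adj f = 𝟙 X
  adj_comp : StarCategory.adj f ≫ f = 𝟙 Y

/-- A `C*`-category: the Hom-spaces are complex Banach spaces, composition is bilinear and
submultiplicative, and the conjugate-linear involution is isometric with `‖f* f‖ = ‖f‖²`. -/
class CStarCategory (C : Type u) [Category.{v} C] extends StarCategory C where
  [homNormed : ∀ X Y : C, NormedAddCommGroup (X ⟶ Y)]
  [homSpace : ∀ X Y : C, NormedSpace ℂ (X ⟶ Y)]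
  [homComplete : ∀ X Y : C, CompleteSpace (X ⟶ Y)]
  add_comp {X Y Z : C} (f f' : X ⟶ Y) (g : Y ⟶ Z) : (f + f') ≫ g = f ≫ g + f' ≫ g
  comp_add {X Y Z : C} (f : X ⟶ Y) (g g' : Y ⟶ Z) : f ≫ (g + g') = f ≫ g + f ≫ g'
  smul_comp {X Y Z : C} (a : ℂ) (f : X ⟶ Y) (g : Y ⟶ Z) : (a • f) ≫ g = a • (f ≫ g)
  comp_smul {X Y Z : C} (a : ℂ) (f : X ⟶ Y) (g : Y ⟶ Z) : f ≫ (a • g) = a • (f ≫ g)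
  norm_comp_le {X Y Z : C} (f : X ⟶ Y) (g : Y ⟶ Z) : ‖f ≫ g‖ ≤ ‖g‖ * ‖f‖
  adj_add {X Y : C} (f g : X ⟶ Y) : adj (f + g) = adj f + adj g
  adj_smul {X Y : C} (a : ℂ) (f : X ⟶ Y) : adj (a • f) = (starRingEnd ℂ a) • adj f
  norm_adj {X Y : C} (f : X ⟶ Y) : ‖adj f‖ = ‖f‖
  norm_comp_adj {X Y : C} (f : X ⟶ Y) : ‖f ≫ adj f‖ = ‖f‖ ^ 2

attribute [reducible, instance] CStarCategory.homNormed CStarCategory.homSpace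
attribute [instance] CStarCategory.homComplete

/-- `P ⊆ E*` is a predual of the normed space `E`: it is closed, and evaluation `E → P*` is
isometric and onto the bounded linear functionals on `P`. -/
structure IsPredual {E : Type v} [NormedAddCommGroup E] [NormedSpace ℂ E]
    (P : Submodule ℂ (StrongDual ℂ E)) : Prop where
  isClosed : IsClosed (P : Set (StrongDual ℂ E))
  norm_le (x : E) (M : ℝ) : 0 ≤ M → (∀ φ ∈ P, ‖φ x‖ ≤ M * ‖φ‖) → ‖x‖ ≤ M
  surjective (Λ : P →ₗ[ℂ] ℂ) (M : ℝ) : (∀ φ : P, ‖Λ φ‖ ≤ M * ‖(φ : StrongDual ℂ E)‖) →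
    ∃ x : E, ∀ φ : P, Λ φ = (φ : StrongDual ℂ E) x

/-- A `W*`-category: a `C*`-category all of whose Hom-spaces are dual Banach spaces. The predual
is recorded as the (closed) space `Hom(X,Y)_*` of ultraweakly continuous functionals. -/
class WStarCategory (C : Type u) [Category.{v} C] extends CStarCategory C where
  predual (X Y : C) : Submodule ℂ (StrongDual ℂ (X ⟶ Y))
  isPredual (X Y : C) : IsPredual (predual X Y)

/-- Compatibility of a monoidal structure with the involution: `(f ⊗ g)* = f* ⊗ g*`, and the
coherence isomorphisms are unitary. -/
class MonoidalStarCategory (C : Type u) [Category.{v} C] [MonoidalCategory C]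
    [StarCategory C] : Prop where
  adj_whiskerLeft (X : C) {Y Z : C} (f : Y ⟶ Z) :
    StarCategory.adj (X ◁ f) = X ◁ StarCategory.adj f
  adj_whiskerRight {X Y : C} (f : X ⟶ Y) (Z : C) :
    StarCategory.adj (f ▷ Z) = StarCategory.adj f ▷ Z
  associator_unitary (X Y Z : C) : IsUnitary (α_ X Y Z).hom
  leftUnitor_unitary (X : C) : IsUnitary (λ_ X).hom
  rightUnitor_unitary (X : C) : IsUnitary (ρ_ X).hom

/-- A monoidal `W*`-category: in addition the tensor product is bilinear and normal, i.e.
ultraweakly continuous in each variable. -/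
class MonoidalWStarCategory (C : Type u) [Category.{v} C] [MonoidalCategory C]
    [WStarCategory C] : Prop extends MonoidalStarCategory C where
  whiskerLeft_add (X : C) {Y Z : C} (f g : Y ⟶ Z) : X ◁ (f + g) = X ◁ f + X ◁ g
  whiskerLeft_smul (X : C) {Y Z : C} (a : ℂ) (f : Y ⟶ Z) : X ◁ (a • f) = a • (X ◁ f)
  add_whiskerRight {X Y : C} (f g : X ⟶ Y) (Z : C) : (f + g) ▷ Z = f ▷ Z + g ▷ Z
  smul_whiskerRight {X Y : C} (a : ℂ) (f : X ⟶ Y) (Z : C) : (a • f) ▷ Z = a • (f ▷ Z)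
  whiskerLeft_normal (X Y Z : C) : ∀ φ ∈ WStarCategory.predual (X ⊗ Y) (X ⊗ Z),
    ∃ ψ ∈ WStarCategory.predual Y Z, ∀ f : Y ⟶ Z, ψ f = φ (X ◁ f)
  whiskerRight_normal (X Y Z : C) : ∀ φ ∈ WStarCategory.predual (X ⊗ Z) (Y ⊗ Z),
    ∃ ψ ∈ WStarCategory.predual X Y, ∀ f : X ⟶ Y, ψ f = φ (f ▷ Z)

/-- The braiding consists of unitaries. -/
class UnitarilyBraided (C : Type u) [Category.{v} C] [MonoidalCategory C] [StarCategory C]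
    [BraidedCategory C] : Prop where
  braiding_unitary (X Y : C) : IsUnitary (β_ X Y).hom

/-! ### Fibre functors -/

/-- The predual `B(E,G)_*`: the closed linear span of the functionals `T ↦ ⟪η, T ξ⟫`. -/
def normalFunctionals (E G : Type w) [NormedAddCommGroup E] [InnerProductSpace ℂ E]
    [NormedAddCommGroup G] [InnerProductSpace ℂ G] : Submodule ℂ (StrongDual ℂ (E →L[ℂ] G)) :=
  (Submodule.span ℂ
    {φ | ∃ (ξ : E) (η : G), ∀ T : E →L[ℂ] G, φ T = ⟪η, T ξ⟫_ℂ}).topologicalClosure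

/-- A strong monoidal `*`-functor (with unitary coherence) to the monoidal category of Hilbert
spaces with the Hilbert space tensor product. The unitaries from the Hilbert space tensor product
of `obj X` and `obj Y` to `obj (X ⊗ Y)` are given by the bilinear maps `tmul`: such a unitary is
the same as a bounded bilinear map with total range and
`⟪x ⊗ y, x' ⊗ y'⟫ = ⟪x, x'⟫ ⟪y, y'⟫`. The unitary from `ℂ` to `obj (𝟙_ C)` is given by the image
`one` of `1`. -/
structure FibreFunctor (C : Type u) [Category.{v} C] [MonoidalCategory C] [StarCategory C] where
  obj : C → Type w
  [normed : ∀ X, NormedAddCommGroup (obj X)]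
  [space : ∀ X, InnerProductSpace ℂ (obj X)]
  [complete : ∀ X, CompleteSpace (obj X)]
  map {X Y : C} (f : X ⟶ Y) : obj X →L[ℂ] obj Y
  map_id (X : C) : map (𝟙 X) = ContinuousLinearMap.id ℂ (obj X)
  map_comp {X Y Z : C} (f : X ⟶ Y) (g : Y ⟶ Z) : map (f ≫ g) = (map g).comp (map f)
  map_adj {X Y : C} (f : X ⟶ Y) : map (StarCategory.adj f) = ContinuousLinearMap.adjoint (map f)
  tmul (X Y : C) : obj X →L[ℂ] obj Y →L[ℂ] obj (X ⊗ Y)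
  inner_tmul {X Y : C} (x x' : obj X) (y y' : obj Y) :
    ⟪tmul X Y x y, tmul X Y x' y'⟫_ℂ = ⟪x, x'⟫_ℂ * ⟪y, y'⟫_ℂ
  span_tmul (X Y : C) :
    (Submodule.span ℂ {z | ∃ x y, tmul X Y x y = z}).topologicalClosure = ⊤
  map_whiskerLeft (X : C) {Y Z : C} (f : Y ⟶ Z) (x : obj X) (y : obj Y) :
    map (X ◁ f) (tmul X Y x y) = tmul X Z x (map f y)
  map_whiskerRight {X Y : C} (f : X ⟶ Y) (Z : C) (x : obj X) (z : obj Z) :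
    map (f ▷ Z) (tmul X Z x z) = tmul Y Z (map f x) z
  one : obj (𝟙_ C)
  norm_one : ‖one‖ = 1
  span_one : Submodule.span ℂ {one} = ⊤
  map_associator (X Y Z : C) (x : obj X) (y : obj Y) (z : obj Z) :
    map (α_ X Y Z).hom (tmul (X ⊗ Y) Z (tmul X Y x y) z) = tmul X (Y ⊗ Z) x (tmul Y Z y z)
  map_leftUnitor (X : C) (x : obj X) : map (λ_ X).hom (tmul (𝟙_ C) X one x) = x
  map_rightUnitor (X : C) (x : obj X) : map (ρ_ X).hom (tmul X (𝟙_ C) x one) = x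

attribute [instance] FibreFunctor.normed FibreFunctor.space FibreFunctor.complete

namespace FibreFunctor

/-- The functor is linear and normal, i.e. ultraweakly continuous on Hom-spaces. A `W*`-category
with such a fibre functor is a concrete monoidal `W*`-category. -/
structure IsNormal {C : Type u} [Category.{v} C] [MonoidalCategory C] [WStarCategory C]
    (R : FibreFunctor.{w} C) : Prop where
  map_add {X Y : C} (f g : X ⟶ Y) : R.map (f + g) = R.map f + R.map g
  map_smul {X Y : C} (a : ℂ) (f : X ⟶ Y) : R.map (a • f) = a • R.map f
  normal (X Y : C) : ∀ φ ∈ normalFunctionals (R.obj X) (R.obj Y),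
    ∃ ψ ∈ WStarCategory.predual X Y, ∀ f : X ⟶ Y, ψ f = φ (R.map f)

variable {C : Type u} [Category.{v} C] [MonoidalCategory C] [StarCategory C]

/-- Injectivity on Hom-spaces. -/
def IsFaithful (R : FibreFunctor.{w} C) : Prop :=
  ∀ (X Y : C) (f g : X ⟶ Y), R.map f = R.map g → f = g

/-- The closed linear span of the slices `(id ⊗ φ)(T)`, `φ ∈ B(obj Y, obj Y')_*`, of an operator
`T` from `obj X ⊗ obj Y` to `obj X' ⊗ obj Y'`. The slice `S = (id ⊗ φ)(T)` is characterised by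
`⟪x', S x⟫ = φ ((⟨x'| ⊗ id) T (|x⟩ ⊗ id))`. -/
def slices (R : FibreFunctor.{w} C) {X Y X' Y' : C} (T : R.obj (X ⊗ Y) →L[ℂ] R.obj (X' ⊗ Y')) :
    Submodule ℂ (R.obj X →L[ℂ] R.obj X') :=
  (Submodule.span ℂ
    {S | ∃ φ ∈ normalFunctionals (R.obj Y) (R.obj Y'), ∀ (x : R.obj X) (x' : R.obj X'),
      ⟪x', S x⟫_ℂ =
        φ ((ContinuousLinearMap.adjoint (R.tmul X' Y' x')).comp
          (T.comp (R.tmul X Y x)))}).topologicalClosure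

/-- The space of compact operators `K(obj X, obj Y)`. -/
def compacts (R : FibreFunctor.{w} C) (X Y : C) : Submodule ℂ (R.obj X →L[ℂ] R.obj Y) :=
  compactOperator (RingHom.id ℂ) (R.obj X) (R.obj Y)

/-- Semi-regularity of a braiding. -/
structure SemiregularBraiding (R : FibreFunctor.{w} C) (c : BraidedCategory C) : Prop where
  unitary (X Y : C) : IsUnitary (c.braiding X Y).hom
  compacts_le (X Y : C) : R.compacts X Y ≤ R.slices (R.map (c.braiding X Y).hom)

/-- Regularity of a braiding. -/
structure RegularBraiding (R : FibreFunctor.{w} C) (c : BraidedCategory C) : Prop where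
  unitary (X Y : C) : IsUnitary (c.braiding X Y).hom
  compacts_eq (X Y : C) : R.compacts X Y = R.slices (R.map (c.braiding X Y).hom)

end FibreFunctor

/-! ### Leg notation in braided categories -/

section Braided

variable {C : Type u} [Category.{v} C] [MonoidalCategory C]

/-- Leg notation `f₁₂ = f ⊗ id_Z`, on the right-bracketed product `X ⊗ (Y ⊗ Z)`.
The operator `f₂₃ = id_X ⊗ f` is `X ◁ f`. -/
def leg12 {X Y X' Y' : C} (f : X ⊗ Y ⟶ X' ⊗ Y') (Z : C) : X ⊗ Y ⊗ Z ⟶ X' ⊗ Y' ⊗ Z :=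
  (α_ X Y Z).inv ≫ f ▷ Z ≫ (α_ X' Y' Z).hom

theorem leg12_comp {X Y X' Y' X'' Y'' : C} (f : X ⊗ Y ⟶ X' ⊗ Y') (g : X' ⊗ Y' ⟶ X'' ⊗ Y'') (Z : C) :
    leg12 (f ≫ g) Z = leg12 f Z ≫ leg12 g Z := by simp [leg12]

theorem leg12_comp_assoc {X Y X' Y' X'' Y'' : C} (f : X ⊗ Y ⟶ X' ⊗ Y') (g : X' ⊗ Y' ⟶ X'' ⊗ Y'')
    (Z : C) {W : C} (h : X'' ⊗ Y'' ⊗ Z ⟶ W) :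
    leg12 (f ≫ g) Z ≫ h = leg12 f Z ≫ leg12 g Z ≫ h := by rw [leg12_comp, Category.assoc]

theorem leg12_id (X Y Z : C) : leg12 (𝟙 (X ⊗ Y)) Z = 𝟙 _ := by simp [leg12]

theorem leg12_whiskerLeft (X : C) {Y Y' : C} (f : Y ⟶ Y') (Z : C) :
    leg12 (X ◁ f) Z = X ◁ f ▷ Z := by simp [leg12]

theorem leg12_whiskerRight {X X' : C} (f : X ⟶ X') (Y Z : C) :
    leg12 (f ▷ Y) Z = f ▷ (Y ⊗ Z) := by simp [leg12]

theorem leg12_hom_inv {X Y X' Y' : C} (e : X ⊗ Y ≅ X' ⊗ Y') (Z : C) :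
    leg12 e.hom Z ≫ leg12 e.inv Z = 𝟙 _ := by
  rw [← leg12_comp, e.hom_inv_id, leg12_id]

theorem leg12_hom_inv_assoc {X Y X' Y' : C} (e : X ⊗ Y ≅ X' ⊗ Y') (Z : C) {W : C}
    (h : X ⊗ Y ⊗ Z ⟶ W) : leg12 e.hom Z ≫ leg12 e.inv Z ≫ h = h := by
  rw [← leg12_comp_assoc, e.hom_inv_id, leg12_id, Category.id_comp]

theorem leg12_inv_hom {X Y X' Y' : C} (e : X ⊗ Y ≅ X' ⊗ Y') (Z : C) :
    leg12 e.inv Z ≫ leg12 e.hom Z = 𝟙 _ := leg12_hom_inv e.symm Z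

theorem leg12_natural {X Y X' Y' : C} (f : X ⊗ Y ⟶ X' ⊗ Y') {Z Z' : C} (g : Z ⟶ Z') :
    leg12 f Z ≫ X' ◁ Y' ◁ g = X ◁ Y ◁ g ≫ leg12 f Z' := by
  simp only [leg12, Category.assoc]
  rw [← associator_naturality_right, ← whisker_exchange_assoc, associator_inv_naturality_right_assoc]

theorem leg12_tensor {X Y X' Y' : C} (f : X ⊗ Y ⟶ X' ⊗ Y') (Z W : C) :
    leg12 f (Z ⊗ W) = X ◁ (α_ Y Z W).inv ≫ leg12 (leg12 f Z : X ⊗ (Y ⊗ Z) ⟶ X' ⊗ (Y' ⊗ Z)) W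
      ≫ X' ◁ (α_ Y' Z W).hom := by
  simp [leg12]

variable [BraidedCategory C]

/-- `f₁₃` for a morphism acting on the outer legs of `X ⊗ Y ⊗ Z`, the line joining the outer legs
passing in front of the middle strand: `f₁₃ = (c_{X',Y}⁻¹)₁₂ ∘ f₂₃ ∘ (c_{X,Y})₁₂`. -/
def over13 {X Z X' Z' : C} (f : X ⊗ Z ⟶ X' ⊗ Z') (Y : C) : X ⊗ Y ⊗ Z ⟶ X' ⊗ Y ⊗ Z' :=
  leg12 (β_ X Y).hom Z ≫ Y ◁ f ≫ leg12 (β_ X' Y).inv Z'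

/-- The same with the joining line passing behind the middle strand:
`(c_{Y,X'})₁₂ ∘ f₂₃ ∘ (c_{Y,X}⁻¹)₁₂`. -/
def under13 {X Z X' Z' : C} (f : X ⊗ Z ⟶ X' ⊗ Z') (Y : C) : X ⊗ Y ⊗ Z ⟶ X' ⊗ Y ⊗ Z' :=
  leg12 (β_ Y X).inv Z ≫ Y ◁ f ≫ leg12 (β_ Y X').hom Z'

theorem over13_comp {X Z X' Z' X'' Z'' : C} (f : X ⊗ Z ⟶ X' ⊗ Z') (g : X' ⊗ Z' ⟶ X'' ⊗ Z'') (Y : C) :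
    over13 (f ≫ g) Y = over13 f Y ≫ over13 g Y := by
  simp [over13, leg12]

theorem over13_id (X Z Y : C) : over13 (𝟙 (X ⊗ Z)) Y = 𝟙 _ := by
  simp [over13, leg12]

theorem over13_eq {X Z X' Z' : C} (f : X ⊗ Z ⟶ X' ⊗ Z') (Y : C) :
    over13 f Y = X ◁ (β_ Z Y).inv ≫ leg12 f Y ≫ X' ◁ (β_ Z' Y).hom := by
  have h := BraidedCategory.braiding_naturality_left f Y
  rw [BraidedCategory.braiding_tensor_left_hom, BraidedCategory.braiding_tensor_left_hom] at h
  have h2 := congrArg (fun t => X ◁ (β_ Z Y).inv ≫ (α_ _ _ _).inv ≫ t ≫ (α_ _ _ _).inv ≫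
    (β_ X' Y).inv ▷ Z' ≫ (α_ _ _ _).hom) h
  simp only [over13, leg12]
  simp at h2 ⊢
  exact h2.symm
 
theorem over13_natural {X Z X' Z' : C} (f : X ⊗ Z ⟶ X' ⊗ Z') {Y Y' : C} (g : Y ⟶ Y') :
    over13 f Y ≫ X' ◁ g ▷ Z' = X ◁ g ▷ Z ≫ over13 f Y' := by
  simp only [over13, ← leg12_whiskerLeft, Category.assoc]
  rw [← leg12_comp, ← BraidedCategory.braiding_inv_naturality_left, leg12_comp,
    ← leg12_comp_assoc, BraidedCategory.braiding_naturality_right, leg12_comp_assoc]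
  simp only [leg12_whiskerRight]
  rw [whisker_exchange_assoc]

theorem over13_tensor {X Z X' Z' : C} (f : X ⊗ Z ⟶ X' ⊗ Z') (Y₁ Y₂ : C) :
    over13 f (Y₁ ⊗ Y₂) = X ◁ (α_ Y₁ Y₂ Z).hom ≫
      over13 (over13 f Y₂ : X ⊗ (Y₂ ⊗ Z) ⟶ X' ⊗ (Y₂ ⊗ Z')) Y₁ ≫ X' ◁ (α_ Y₁ Y₂ Z').inv := by
  simp [over13, leg12]

theorem over13_whiskerLeft (X : C) {Z Z' : C} (f : Z ⟶ Z') (Y : C) :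
    over13 (X ◁ f) Y = X ◁ Y ◁ f := by
  simp only [over13]
  rw [← leg12_natural, ← leg12_comp_assoc, Iso.hom_inv_id, leg12_id, Category.id_comp]
  

theorem over13_whiskerRight {X X' : C} (f : X ⟶ X') (Z Y : C) :
    over13 (f ▷ Z) Y = f ▷ (Y ⊗ Z) := by
  simp only [over13, ← leg12_whiskerLeft, ← leg12_whiskerRight]
  rw [← leg12_comp, ← leg12_comp]; simp 

theorem leg12_over13 {X Z X' Z' : C} (f : X ⊗ Z ⟶ X' ⊗ Z') (Y W : C) :
   leg12 (over13 f Y : X ⊗ (Y ⊗ Z) ⟶ X' ⊗ (Y ⊗ Z')) W = X ◁ (α_ Y Z W).hom ≫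
      over13 (leg12 f W : X ⊗ (Z ⊗ W) ⟶ X' ⊗ (Z' ⊗ W)) Y ≫ X' ◁ (α_ Y Z' W).inv := by
  simp [over13, leg12]

theorem over13_unit {X Z X' Z' : C} (f : X ⊗ Z ⟶ X' ⊗ Z')  :
   over13 f (𝟙_ C) = X ◁ (λ_ Z).hom ≫ f ≫ X' ◁ (λ_ Z').inv := by
  simp [over13, leg12]

variable {L : C} (F : L ⊗ L ⟶ L ⊗ L)

/-- The Pentagon equation `F₂₃ F₁₂ = F₁₂ F₁₃ F₂₃` with `F₁₃ = (c_{L,L}⁻¹)₁₂ F₂₃ (c_{L,L})₁₂`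
(`≫` composes in diagrammatic order). -/
def PentagonEquation : Prop :=
  leg12 F L ≫ L ◁ F = L ◁ F ≫ over13 F L ≫ leg12 F L

/-- The corepresentation equation `F₂₃ U₁₂ = U₁₂ U₁₃ F₂₃` on `H ⊗ L ⊗ L`. -/
def IsCorep {H : C} (U : H ⊗ L ⟶ H ⊗ L) : Prop :=
  leg12 U L ≫ H ◁ F = H ◁ F ≫ over13 U L ≫ leg12 U L

/-- The representation equation `V₂₃ F₁₂ = F₁₂ V₁₃ V₂₃` on `L ⊗ L ⊗ H`. -/
def IsRep {H : C} (V : L ⊗ H ⟶ L ⊗ H) : Prop :=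
  leg12 F H ≫ L ◁ V = L ◁ V ≫ over13 V L ≫ leg12 F H

/-- The Yetter-Drinfeld equation `V₁₂ F₁₃ U₂₃ = U₂₃ F'₁₃ V₁₂` on `L ⊗ H ⊗ L`; on the left the
line of `F` passes in front of the strand `H`, on the right it passes behind. -/
def IsYD {H : C} (U : H ⊗ L ⟶ H ⊗ L) (V : L ⊗ H ⟶ L ⊗ H) : Prop :=
  L ◁ U ≫ over13 F H ≫ leg12 V L = leg12 V L ≫ under13 F H ≫ L ◁ U

/-- The tensor product `(U₁)₁₃ (U₂)₂₃` of corepresentations, on `(H₁ ⊗ H₂) ⊗ L`. -/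
def tensorCorep {H₁ H₂ : C} (U₁ : H₁ ⊗ L ⟶ H₁ ⊗ L) (U₂ : H₂ ⊗ L ⟶ H₂ ⊗ L) :
    (H₁ ⊗ H₂) ⊗ L ⟶ (H₁ ⊗ H₂) ⊗ L :=
  (α_ H₁ H₂ L).hom ≫ H₁ ◁ U₂ ≫ over13 U₁ H₂ ≫ (α_ H₁ H₂ L).inv

/-- The tensor product of the left structures of Yetter-Drinfeld modules, on `L ⊗ H₁ ⊗ H₂`:
first `V₁` on the legs `L`, `H₁`, then `V₂` on `L`, `H₂` passing behind `H₁`. -/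
def tensorRep {H₁ H₂ : C} (V₁ : L ⊗ H₁ ⟶ L ⊗ H₁) (V₂ : L ⊗ H₂ ⟶ L ⊗ H₂) :
    L ⊗ H₁ ⊗ H₂ ⟶ L ⊗ H₁ ⊗ H₂ :=
  leg12 V₁ H₂ ≫ under13 V₂ H₁

theorem under13_comp {X Z X' Z' X'' Z'' : C} (f : X ⊗ Z ⟶ X' ⊗ Z') (g : X' ⊗ Z' ⟶ X'' ⊗ Z'')
    (Y : C) : under13 (f ≫ g) Y = under13 f Y ≫ under13 g Y :=
  @over13_comp C _ _ (reverseBraiding C) _ _ _ _ _ _ f g Y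

theorem under13_id (X Z Y : C) : under13 (𝟙 (X ⊗ Z)) Y = 𝟙 _ :=
  @over13_id C _ _ (reverseBraiding C) X Z Y

theorem under13_eq {X Z X' Z' : C} (f : X ⊗ Z ⟶ X' ⊗ Z') (Y : C) :
    under13 f Y = X ◁ (β_ Y Z).hom ≫ leg12 f Y ≫ X' ◁ (β_ Y Z').inv :=
  @over13_eq C _ _ (reverseBraiding C) _ _ _ _ f Y

theorem under13_natural {X Z X' Z' : C} (f : X ⊗ Z ⟶ X' ⊗ Z') {Y Y' : C} (g : Y ⟶ Y') :
    under13 f Y ≫ X' ◁ g ▷ Z' = X ◁ g ▷ Z ≫ under13 f Y' :=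
  @over13_natural C _ _ (reverseBraiding C) _ _ _ _ f _ _ g

theorem under13_tensor {X Z X' Z' : C} (f : X ⊗ Z ⟶ X' ⊗ Z') (Y₁ Y₂ : C) :
    under13 f (Y₁ ⊗ Y₂) = X ◁ (α_ Y₁ Y₂ Z).hom ≫
      under13 (under13 f Y₂ : X ⊗ (Y₂ ⊗ Z) ⟶ X' ⊗ (Y₂ ⊗ Z')) Y₁ ≫ X' ◁ (α_ Y₁ Y₂ Z').inv :=
  @over13_tensor C _ _ (reverseBraiding C) _ _ _ _ f Y₁ Y₂

theorem under13_whiskerLeft (X : C) {Z Z' : C} (f : Z ⟶ Z') (Y : C) :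
    under13 (X ◁ f) Y = X ◁ Y ◁ f :=
  @over13_whiskerLeft C _ _ (reverseBraiding C) X _ _ f Y

theorem under13_whiskerRight {X X' : C} (f : X ⟶ X') (Z Y : C) :
    under13 (f ▷ Z) Y = f ▷ (Y ⊗ Z) :=
  @over13_whiskerRight C _ _ (reverseBraiding C) _ _ f Z Y

theorem leg12_under13 {X Z X' Z' : C} (f : X ⊗ Z ⟶ X' ⊗ Z') (Y W : C) :
    leg12 (under13 f Y : X ⊗ (Y ⊗ Z) ⟶ X' ⊗ (Y ⊗ Z')) W = X ◁ (α_ Y Z W).hom ≫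
      under13 (leg12 f W : X ⊗ (Z ⊗ W) ⟶ X' ⊗ (Z' ⊗ W)) Y ≫ X' ◁ (α_ Y Z' W).inv :=
  @leg12_over13 C _ _ (reverseBraiding C) _ _ _ _ f Y W

theorem under13_unit {X Z X' Z' : C} (f : X ⊗ Z ⟶ X' ⊗ Z') :
    under13 f (𝟙_ C) = X ◁ (λ_ Z).hom ≫ f ≫ X' ◁ (λ_ Z').inv :=
  @over13_unit C _ _ (reverseBraiding C) _ _ _ _ f

variable {F}

theorem leg12_tensorCorep {A B : C} (U₁ : A ⊗ L ⟶ A ⊗ L) (U₂ : B ⊗ L ⟶ B ⊗ L) (Y : C) :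
    leg12 (tensorCorep U₁ U₂) Y = (α_ A B (L ⊗ Y)).hom ≫ A ◁ leg12 U₂ Y ≫
      over13 (leg12 U₁ Y : A ⊗ (L ⊗ Y) ⟶ A ⊗ (L ⊗ Y)) B ≫ (α_ A B (L ⊗ Y)).inv := by
  simp [tensorCorep, over13, leg12]

theorem over13_tensorCorep {A B : C} (U₁ : A ⊗ L ⟶ A ⊗ L) (U₂ : B ⊗ L ⟶ B ⊗ L) (Y : C) :
    over13 (tensorCorep U₁ U₂) Y = (α_ A B (Y ⊗ L)).hom ≫ A ◁ over13 U₂ Y ≫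
      over13 (over13 U₁ Y : A ⊗ (Y ⊗ L) ⟶ A ⊗ (Y ⊗ L)) B ≫ (α_ A B (Y ⊗ L)).inv := by
  rw [over13_eq, over13_eq U₁, over13_eq U₂, over13_comp, over13_comp, over13_whiskerLeft,
    over13_whiskerLeft, leg12_tensorCorep]
  simp only [MonoidalCategory.whiskerLeft_comp, Category.assoc, tensor_whiskerLeft, Iso.inv_hom_id_assoc]
  simp only [← MonoidalCategory.whiskerLeft_comp_assoc,
    MonoidalCategory.whiskerLeft_hom_inv, Category.comp_id]

theorem leg_comm₁ {A B X Y : C} (U₁ : A ⊗ X ⟶ A ⊗ X) (g : B ⊗ L ⟶ B ⊗ Y) :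
    A ◁ leg12 g X ≫ over13 (over13 U₁ Y : A ⊗ (Y ⊗ X) ⟶ A ⊗ (Y ⊗ X)) B =
      over13 (over13 U₁ L : A ⊗ (L ⊗ X) ⟶ A ⊗ (L ⊗ X)) B ≫ A ◁ leg12 g X := by
  have h := over13_natural U₁ g
  rw [over13_tensor, over13_tensor] at h
  have h2 := congrArg (fun t => A ◁ (α_ _ _ _).inv ≫ t ≫ A ◁ (α_ _ _ _).hom) h
  simp [leg12] at h2 ⊢
  exact h2.symm

theorem IsCorep.tensor {A B : C} {U₁ : A ⊗ L ⟶ A ⊗ L} {U₂ : B ⊗ L ⟶ B ⊗ L}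
    (h₁ : IsCorep F U₁) (h₂ : IsCorep F U₂) : IsCorep F (tensorCorep U₁ U₂) := by
  have e₁ := congrArg (fun t => over13 t B) h₁
  have e₂ := congrArg (fun t => A ◁ t) h₂
  simp only [over13_comp, over13_whiskerLeft, MonoidalCategory.whiskerLeft_comp] at e₁ e₂
  rw [IsCorep, leg12_tensorCorep, over13_tensorCorep]
  simp only [tensor_whiskerLeft, Category.assoc, Iso.inv_hom_id_assoc]
  rw [reassoc_of% e₁, reassoc_of% e₂, ← reassoc_of% (leg_comm₁ U₁ U₂)]

theorem leg12_rep {A : C} {V : L ⊗ A ⟶ L ⊗ A} (h : IsRep F V) (B : C) :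
    leg12 F (A ⊗ B) ≫ L ◁ leg12 V B = L ◁ leg12 V B ≫ over13 (leg12 V B) L ≫ leg12 F (A ⊗ B) := by
  have e := congrArg (fun t => L ◁ (α_ _ _ _).inv ≫ leg12 t B ≫ L ◁ (α_ _ _ _).hom) h
  simp only [leg12_comp, leg12_over13, leg12_whiskerLeft] at e
  rw [leg12_tensor]
  simp [leg12] at e ⊢
  exact e

theorem leg_comm₂ {A B X Y M : C} (U₁ : A ⊗ X ⟶ A ⊗ X) (g : B ⊗ M ⟶ B ⊗ Y) :
    A ◁ leg12 g X ≫ under13 (under13 U₁ Y : A ⊗ (Y ⊗ X) ⟶ A ⊗ (Y ⊗ X)) B =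
      under13 (under13 U₁ M : A ⊗ (M ⊗ X) ⟶ A ⊗ (M ⊗ X)) B ≫ A ◁ leg12 g X :=
  @leg_comm₁ C _ _ (reverseBraiding C) M A B X Y U₁ g

theorem IsRep.tensor {A B : C} {V₁ : L ⊗ A ⟶ L ⊗ A} {V₂ : L ⊗ B ⟶ L ⊗ B}
    (h₁ : IsRep F V₁) (h₂ : IsRep F V₂) : IsRep F (tensorRep V₁ V₂) := by
  have e₁ := leg12_rep h₁ B
  have e₂ := leg12_rep h₂ A
  have e₃ : leg12 F (A ⊗ B) ≫ L ◁ under13 V₂ A =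
      L ◁ under13 V₂ A ≫ over13 (under13 V₂ A) L ≫ leg12 F (A ⊗ B) := by
    rw [under13_eq, over13_comp, over13_comp, over13_whiskerLeft, over13_whiskerLeft]
    simp only [MonoidalCategory.whiskerLeft_comp, Category.assoc]
    rw [← leg12_natural, reassoc_of% (leg12_natural F (β_ A B).hom), reassoc_of% e₂]
    simp
  have e₄ : over13 (leg12 V₁ B) L ≫ L ◁ under13 V₂ A = L ◁ under13 V₂ A ≫ over13 (leg12 V₁ B) L := by
    have t := congrArg (fun t => leg12 (β_ L L).hom (A ⊗ B) ≫ t ≫ leg12 (β_ L L).inv (A ⊗ B))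
      (leg_comm₂ V₂ V₁)
    rw [under13.eq_1 (under13 V₂ A : L ⊗ (A ⊗ B) ⟶ L ⊗ (A ⊗ B)) L] at t
    simp only [Category.assoc, leg12_hom_inv, Category.comp_id, leg12_hom_inv_assoc] at t
    simpa only [over13, Category.assoc] using t
  simp only [IsRep, tensorRep, MonoidalCategory.whiskerLeft_comp, over13_comp, Category.assoc]
  rw [reassoc_of% e₁, e₃, reassoc_of% e₄]

theorem IsYD.tensor {A B : C} {U₁ : A ⊗ L ⟶ A ⊗ L} {V₁ : L ⊗ A ⟶ L ⊗ A}
    {U₂ : B ⊗ L ⟶ B ⊗ L} {V₂ : L ⊗ B ⟶ L ⊗ B}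
    (h₁ : IsYD F U₁ V₁) (h₂ : IsYD F U₂ V₂) :
    IsYD F (tensorCorep U₁ U₂) (tensorRep V₁ V₂) := by
  have e₁ : L ◁ over13 U₁ B ≫ over13 (over13 F B : L ⊗ (B ⊗ L) ⟶ L ⊗ (B ⊗ L)) A ≫ leg12 V₁ (B ⊗ L) =
      leg12 V₁ (B ⊗ L) ≫ under13 (over13 F B : L ⊗ (B ⊗ L) ⟶ L ⊗ (B ⊗ L)) A ≫ L ◁ over13 U₁ B := by
    have := congrArg (fun t => L ◁ A ◁ (β_ L B).inv ≫ L ◁ (α_ _ _ _).inv ≫ leg12 t B ≫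
      L ◁ (α_ _ _ _).hom ≫ L ◁ A ◁ (β_ L B).hom) h₁
    have a₁ : L ◁ over13 U₁ B = L ◁ A ◁ (β_ L B).inv ≫ L ◁ (α_ _ _ _).inv ≫ leg12 (L ◁ U₁) B ≫
      L ◁ (α_ _ _ _).hom ≫ L ◁ A ◁ (β_ L B).hom := by
      simp [over13_eq, leg12]
    have a₂ : leg12 V₁ (B ⊗ L) = L ◁ A ◁ (β_ L B).inv ≫ L ◁ (α_ _ _ _).inv ≫ leg12 (leg12 V₁ L) B ≫
      L ◁ (α_ _ _ _).hom ≫ L ◁ A ◁ (β_ L B).hom := by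
      have t := leg12_tensor V₁ L B
      rw [← reassoc_of% t, leg12_natural, ← MonoidalCategory.whiskerLeft_comp_assoc,
        ← MonoidalCategory.whiskerLeft_comp, Iso.inv_hom_id]
      simp
    have a₃ : over13 (over13 F B : L ⊗ (B ⊗ L) ⟶ L ⊗ (B ⊗ L)) A = L ◁ A ◁ (β_ L B).inv ≫ L ◁ (α_ _ _ _).inv ≫ leg12 (over13 F A) B ≫
      L ◁ (α_ _ _ _).hom ≫ L ◁ A ◁ (β_ L B).hom := by
      simp [over13_eq F B, leg12_over13, over13_comp, over13_whiskerLeft]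
    have a₄ : under13 (over13 F B : L ⊗ (B ⊗ L) ⟶ L ⊗ (B ⊗ L)) A = L ◁ A ◁ (β_ L B).inv ≫ L ◁ (α_ _ _ _).inv ≫ leg12 (under13 F A) B ≫
      L ◁ (α_ _ _ _).hom ≫ L ◁ A ◁ (β_ L B).hom := by
      simp [over13_eq F B, leg12_under13, under13_comp, under13_whiskerLeft]
    rw [a₁, a₂, a₃, a₄]
    simp only [leg12_comp] at this
    simpa using this
  have e₂ := congrArg (fun t => under13 t A) h₂
  simp only [under13_comp, under13_whiskerLeft] at e₂
  have e₃ : L ◁ over13 U₁ B ≫ under13 (leg12 V₂ L : L ⊗ (B ⊗ L) ⟶ L ⊗ (B ⊗ L)) A =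
      under13 (leg12 V₂ L : L ⊗ (B ⊗ L) ⟶ L ⊗ (B ⊗ L)) A ≫ L ◁ over13 U₁ B := by
    have a : under13 (leg12 V₂ L : L ⊗ (B ⊗ L) ⟶ L ⊗ (B ⊗ L)) A =
      L ◁ leg12 (β_ A B).hom L ≫ leg12 V₂ (A ⊗ L) ≫ L ◁ leg12 (β_ A B).inv L := by
      have t := congrArg (fun t => L ◁ (α_ _ _ _).inv ≫ t ≫ L ◁ (α_ _ _ _).hom)
        (leg12_under13 V₂ A L)
      simp only [Category.assoc, MonoidalCategory.whiskerLeft_inv_hom_assoc,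
        MonoidalCategory.whiskerLeft_inv_hom, Category.comp_id] at t
      rw [← t, under13_eq, leg12_comp, leg12_comp, leg12_tensor]
      simp [leg12]
    have t := leg12_natural V₂ U₁
    rw [a, over13]
    simp only [MonoidalCategory.whiskerLeft_comp, Category.assoc]
    have z : L ◁ leg12 (β_ A B).inv L ≫ L ◁ leg12 (β_ A B).hom L = 𝟙 _ := by
      rw [← MonoidalCategory.whiskerLeft_comp, leg12_inv_hom, MonoidalCategory.whiskerLeft_id]
    rw [reassoc_of% z, reassoc_of% z, reassoc_of% t]
  have e₄ := leg12_natural V₁ U₂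
  have b₁ : L ◁ tensorCorep U₁ U₂ = L ◁ (α_ A B L).hom ≫ L ◁ A ◁ U₂ ≫ L ◁ over13 U₁ B ≫
      L ◁ (α_ A B L).inv := by simp [tensorCorep]
  have b₂ : leg12 (tensorRep V₁ V₂) L = L ◁ (α_ A B L).hom ≫ leg12 V₁ (B ⊗ L) ≫
      under13 (leg12 V₂ L : L ⊗ (B ⊗ L) ⟶ L ⊗ (B ⊗ L)) A ≫ L ◁ (α_ A B L).inv := by
    rw [tensorRep, leg12_comp, leg12_under13, leg12_tensor]
    simp
  rw [IsYD, b₁, b₂, over13_tensor, under13_tensor]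
  simp only [Category.assoc, MonoidalCategory.whiskerLeft_inv_hom_assoc]
  rw [reassoc_of% e₁, reassoc_of% e₃, ← reassoc_of% e₄, reassoc_of% e₂]

theorem tensorCorep_whiskerLeft {A B B' : C} (U₁ : A ⊗ L ⟶ A ⊗ L) {U₂ : B ⊗ L ⟶ B ⊗ L}
    {U₂' : B' ⊗ L ⟶ B' ⊗ L} {f : B ⟶ B'} (h : U₂ ≫ f ▷ L = f ▷ L ≫ U₂') :
    tensorCorep U₁ U₂ ≫ (A ◁ f) ▷ L = (A ◁ f) ▷ L ≫ tensorCorep U₁ U₂' := by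
  have t := over13_natural U₁ f
  have e := congrArg (fun t => A ◁ t) h
  simp only [MonoidalCategory.whiskerLeft_comp] at e
  simp only [tensorCorep, whisker_assoc, Category.assoc, Iso.inv_hom_id_assoc]
  rw [reassoc_of% t, reassoc_of% e]

theorem tensorCorep_whiskerRight {A A' B : C} {U₁ : A ⊗ L ⟶ A ⊗ L} {U₁' : A' ⊗ L ⟶ A' ⊗ L}
    (U₂ : B ⊗ L ⟶ B ⊗ L) {f : A ⟶ A'} (h : U₁ ≫ f ▷ L = f ▷ L ≫ U₁') :
    tensorCorep U₁ U₂ ≫ (f ▷ B) ▷ L = (f ▷ B) ▷ L ≫ tensorCorep U₁' U₂ := by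
  have e := congrArg (fun t => over13 t B) h
  simp only [over13_comp, over13_whiskerRight] at e
  simp only [tensorCorep, whiskerRight_tensor_symm, Category.assoc, Iso.inv_hom_id_assoc]
  rw [reassoc_of% e, whisker_exchange_assoc]

theorem tensorRep_whiskerLeft {A B B' : C} (V₁ : L ⊗ A ⟶ L ⊗ A) {V₂ : L ⊗ B ⟶ L ⊗ B}
    {V₂' : L ⊗ B' ⟶ L ⊗ B'} {f : B ⟶ B'} (h : V₂ ≫ L ◁ f = L ◁ f ≫ V₂') :
    tensorRep V₁ V₂ ≫ L ◁ A ◁ f = L ◁ A ◁ f ≫ tensorRep V₁ V₂' := by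
  have e := congrArg (fun t => under13 t A) h
  simp only [under13_comp, under13_whiskerLeft] at e
  rw [tensorRep, tensorRep, Category.assoc, e, reassoc_of% (leg12_natural V₁ f)]

theorem tensorRep_whiskerRight {A A' B : C} {V₁ : L ⊗ A ⟶ L ⊗ A} {V₁' : L ⊗ A' ⟶ L ⊗ A'}
    (V₂ : L ⊗ B ⟶ L ⊗ B) {f : A ⟶ A'} (h : V₁ ≫ L ◁ f = L ◁ f ≫ V₁') :
    tensorRep V₁ V₂ ≫ L ◁ f ▷ B = L ◁ f ▷ B ≫ tensorRep V₁' V₂ := by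
  have e := congrArg (fun t => leg12 t B) h
  simp only [leg12_comp, leg12_whiskerLeft] at e
  rw [tensorRep, tensorRep, Category.assoc, under13_natural, reassoc_of% e]

theorem tensorCorep_assoc {A B D : C} (U₁ : A ⊗ L ⟶ A ⊗ L) (U₂ : B ⊗ L ⟶ B ⊗ L)
    (U₃ : D ⊗ L ⟶ D ⊗ L) :
    tensorCorep (tensorCorep U₁ U₂) U₃ ≫ (α_ A B D).hom ▷ L =
      (α_ A B D).hom ▷ L ≫ tensorCorep U₁ (tensorCorep U₂ U₃) := by
  rw [tensorCorep, over13_tensorCorep, tensorCorep, over13_tensor, tensorCorep]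
  simp

theorem tensorRep_assoc {A B D : C} (V₁ : L ⊗ A ⟶ L ⊗ A) (V₂ : L ⊗ B ⟶ L ⊗ B)
    (V₃ : L ⊗ D ⟶ L ⊗ D) :
    tensorRep (tensorRep V₁ V₂) V₃ ≫ L ◁ (α_ A B D).hom =
      L ◁ (α_ A B D).hom ≫ tensorRep V₁ (tensorRep V₂ V₃) := by
  rw [tensorRep, tensorRep, leg12_comp, under13_tensor, leg12_under13, tensorRep, tensorRep,
    under13_comp, leg12_tensor]
  simp

theorem tensorCorep_leftUnitor {A : C} (U : A ⊗ L ⟶ A ⊗ L) :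
    tensorCorep (𝟙 (𝟙_ C ⊗ L)) U ≫ (λ_ A).hom ▷ L = (λ_ A).hom ▷ L ≫ U := by
  simp [tensorCorep, over13_id]

theorem tensorCorep_rightUnitor {A : C} (U : A ⊗ L ⟶ A ⊗ L) :
    tensorCorep U (𝟙 (𝟙_ C ⊗ L)) ≫ (ρ_ A).hom ▷ L = (ρ_ A).hom ▷ L ≫ U := by
  simp [tensorCorep, over13_unit]

theorem tensorRep_leftUnitor {A : C} (V : L ⊗ A ⟶ L ⊗ A) :
    tensorRep (𝟙 (L ⊗ 𝟙_ C)) V ≫ L ◁ (λ_ A).hom = L ◁ (λ_ A).hom ≫ V := by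
  simp [tensorRep, under13_unit, leg12_id]

theorem tensorRep_rightUnitor {A : C} (V : L ⊗ A ⟶ L ⊗ A) :
    tensorRep V (𝟙 (L ⊗ 𝟙_ C)) ≫ L ◁ (ρ_ A).hom = L ◁ (ρ_ A).hom ≫ V := by
  simp [tensorRep, under13_id, leg12]

theorem isCorep_unit : IsCorep F (𝟙 (𝟙_ C ⊗ L)) := by
  simp [IsCorep, over13_id, leg12_id]

theorem isRep_unit : IsRep F (𝟙 (L ⊗ 𝟙_ C)) := by
  simp [IsRep, over13_id]

theorem isYD_unit : IsYD F (𝟙 (𝟙_ C ⊗ L)) (𝟙 (L ⊗ 𝟙_ C)) := by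
  simp [IsYD, over13_unit, under13_unit, leg12_id]

end Braided

/-! ### Unitarity -/

section Unitary

variable {C : Type u} [Category.{v} C] [StarCategory C]

theorem adj_id (X : C) : StarCategory.adj (𝟙 X) = 𝟙 X := by
  have h := StarCategory.adj_comp (StarCategory.adj (𝟙 X)) (𝟙 X)
  rw [Category.comp_id, StarCategory.adj_adj, Category.comp_id] at h
  exact h.symm

theorem isUnitary_id (X : C) : IsUnitary (𝟙 X) := by
  constructor <;> rw [adj_id, Category.comp_id]

theorem IsUnitary.comp {X Y Z : C} {f : X ⟶ Y} {g : Y ⟶ Z} (hf : IsUnitary f)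
    (hg : IsUnitary g) : IsUnitary (f ≫ g) := by
  constructor
  · rw [StarCategory.adj_comp, Category.assoc, reassoc_of% hg.comp_adj, hf.comp_adj]
  · rw [StarCategory.adj_comp, Category.assoc, reassoc_of% hf.adj_comp, hg.adj_comp]

theorem IsUnitary.adj {X Y : C} {f : X ⟶ Y} (hf : IsUnitary f) :
    IsUnitary (StarCategory.adj f) := by
  constructor <;> rw [StarCategory.adj_adj]
  exacts [hf.adj_comp, hf.comp_adj]

theorem IsUnitary.inv_eq {X Y : C} {e : X ≅ Y} (he : IsUnitary e.hom) :
    e.inv = StarCategory.adj e.hom := by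
  rw [← cancel_epi e.hom, he.comp_adj, e.hom_inv_id]

theorem IsUnitary.inv {X Y : C} {e : X ≅ Y} (he : IsUnitary e.hom) : IsUnitary e.inv := by
  rw [he.inv_eq]
  exact he.adj

variable [MonoidalCategory C] [MonoidalStarCategory C]

theorem IsUnitary.whiskerLeft (X : C) {Y Z : C} {f : Y ⟶ Z} (hf : IsUnitary f) :
    IsUnitary (X ◁ f) := by
  constructor <;> rw [MonoidalStarCategory.adj_whiskerLeft, ← MonoidalCategory.whiskerLeft_comp]
  · rw [hf.comp_adj, MonoidalCategory.whiskerLeft_id]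
  · rw [hf.adj_comp, MonoidalCategory.whiskerLeft_id]

theorem IsUnitary.whiskerRight {X Y : C} {f : X ⟶ Y} (hf : IsUnitary f) (Z : C) :
    IsUnitary (f ▷ Z) := by
  constructor <;> rw [MonoidalStarCategory.adj_whiskerRight, ← MonoidalCategory.comp_whiskerRight]
  · rw [hf.comp_adj, MonoidalCategory.id_whiskerRight]
  · rw [hf.adj_comp, MonoidalCategory.id_whiskerRight]

theorem IsUnitary.leg12 {X Y X' Y' : C} {f : X ⊗ Y ⟶ X' ⊗ Y'} (hf : IsUnitary f) (Z : C) :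
    IsUnitary (BraidedMU.leg12 f Z) :=
  (MonoidalStarCategory.associator_unitary X Y Z).inv.comp
    ((hf.whiskerRight Z).comp (MonoidalStarCategory.associator_unitary X' Y' Z))

variable [BraidedCategory C] [UnitarilyBraided C]

theorem IsUnitary.over13 {X Z X' Z' : C} {f : X ⊗ Z ⟶ X' ⊗ Z'} (hf : IsUnitary f) (Y : C) :
    IsUnitary (BraidedMU.over13 f Y) :=
  ((UnitarilyBraided.braiding_unitary X Y).leg12 Z).comp
    ((hf.whiskerLeft Y).comp ((UnitarilyBraided.braiding_unitary X' Y).inv.leg12 Z'))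

theorem IsUnitary.under13 {X Z X' Z' : C} {f : X ⊗ Z ⟶ X' ⊗ Z'} (hf : IsUnitary f) (Y : C) :
    IsUnitary (BraidedMU.under13 f Y) :=
  ((UnitarilyBraided.braiding_unitary Y X).inv.leg12 Z).comp
    ((hf.whiskerLeft Y).comp ((UnitarilyBraided.braiding_unitary Y X').leg12 Z'))

end Unitary

/-! ### Multiplicative unitaries -/

section MU

variable {C : Type u} [Category.{v} C] [StarCategory C] [MonoidalCategory C] [BraidedCategory C]

/-- Multiplicative unitaries in a braided category. -/
structure IsMultiplicativeUnitary {L : C} (F : L ⊗ L ⟶ L ⊗ L) : Prop where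
  unitary : IsUnitary F
  pentagon : PentagonEquation F

/-- `F` is semi-regular: `K(L) ⊆ [(id ⊗ φ)(c⁻¹ ∘ F)]`. -/
def FibreFunctor.SemiregularMU (R : FibreFunctor.{w} C) {L : C} (F : L ⊗ L ⟶ L ⊗ L) : Prop :=
  R.compacts L L ≤ R.slices (R.map (F ≫ (β_ L L).inv))

/-- `F` is regular: `K(L) = [(id ⊗ φ)(c⁻¹ ∘ F)]`. -/
def FibreFunctor.RegularMU (R : FibreFunctor.{w} C) {L : C} (F : L ⊗ L ⟶ L ⊗ L) : Prop :=
  R.compacts L L = R.slices (R.map (F ≫ (β_ L L).inv))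

/-! ### The Yetter-Drinfeld category -/

/-- A Yetter-Drinfeld module `(H, U, V)` of `F`. -/
structure YD {L : C} (F : L ⊗ L ⟶ L ⊗ L) where
  obj : C
  U : obj ⊗ L ⟶ obj ⊗ L
  V : L ⊗ obj ⟶ L ⊗ obj
  unitary_U : IsUnitary U
  unitary_V : IsUnitary V
  isCorep : IsCorep F U
  isRep : IsRep F V
  isYD : IsYD F U V

namespace YD

variable {L : C} {F : L ⊗ L ⟶ L ⊗ L}

/-- Morphisms of Yetter-Drinfeld modules. -/
@[ext]
structure Hom (X Y : YD F) where
  hom : X.obj ⟶ Y.obj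
  comm_U : X.U ≫ hom ▷ L = hom ▷ L ≫ Y.U
  comm_V : X.V ≫ L ◁ hom = L ◁ hom ≫ Y.V

instance : Category (YD F) where
  Hom := Hom
  id X := ⟨𝟙 X.obj, by simp, by simp⟩
  comp f g := ⟨f.hom ≫ g.hom,
    by rw [MonoidalCategory.comp_whiskerRight, reassoc_of% f.comm_U, g.comm_U, Category.assoc],
    by rw [MonoidalCategory.whiskerLeft_comp, reassoc_of% f.comm_V, g.comm_V, Category.assoc]⟩
  id_comp f := Hom.ext (Category.id_comp f.hom)
  comp_id f := Hom.ext (Category.comp_id f.hom)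
  assoc f g h := Hom.ext (Category.assoc f.hom g.hom h.hom)

@[ext]
theorem hom_ext {X Y : YD F} {f g : X ⟶ Y} (h : f.hom = g.hom) : f = g := Hom.ext h

@[simp]
theorem id_hom (X : YD F) : Hom.hom (𝟙 X) = 𝟙 X.obj := rfl

@[simp]
theorem comp_hom {X Y Z : YD F} (f : X ⟶ Y) (g : Y ⟶ Z) : (f ≫ g).hom = f.hom ≫ g.hom := rfl

/-- Isomorphisms of Yetter-Drinfeld modules from intertwining isomorphisms. -/
def isoMk {X Y : YD F} (e : X.obj ≅ Y.obj) (hU : X.U ≫ e.hom ▷ L = e.hom ▷ L ≫ Y.U)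
    (hV : X.V ≫ L ◁ e.hom = L ◁ e.hom ≫ Y.V) : X ≅ Y where
  hom := ⟨e.hom, hU, hV⟩
  inv := ⟨e.inv,
    by rw [← cancel_epi (e.hom ▷ L), ← reassoc_of% hU]; simp,
    by rw [← cancel_epi (L ◁ e.hom), ← reassoc_of% hV]; simp⟩
  hom_inv_id := Hom.ext e.hom_inv_id
  inv_hom_id := Hom.ext e.inv_hom_id

/-- The morphism `U₁₂* V₂₃ U₁₂ V₂₃*` on `H ⊗ L ⊗ K`, for `U = X.U`, `V = Y.V`. -/
def starMorphism (X Y : YD F) : X.obj ⊗ L ⊗ Y.obj ⟶ X.obj ⊗ L ⊗ Y.obj :=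
  X.obj ◁ StarCategory.adj Y.V ≫ leg12 X.U Y.obj ≫ X.obj ◁ Y.V ≫
    leg12 (StarCategory.adj X.U) Y.obj

/-- The morphism `W` is `V ∗ U`: one has `W₁₃ = U₁₂* V₂₃ U₁₂ V₂₃*` on `H ⊗ L ⊗ K`. -/
def IsStarProduct (X Y : YD F) (W : X.obj ⊗ Y.obj ⟶ X.obj ⊗ Y.obj) : Prop :=
  over13 W L = starMorphism X Y

/-- The bounded operator `T` is `V ∗ U`: with `T₁₃ = (c_{K,L})₂₃ (T ⊗ id) (c_{K,L}⁻¹)₂₃`, one has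
`T₁₃ = U₁₂* V₂₃ U₁₂ V₂₃*` as bounded operators on the Hilbert space underlying `H ⊗ L ⊗ K`. -/
def IsStarOperator (R : FibreFunctor.{w} C) (X Y : YD F)
    (T : R.obj (X.obj ⊗ Y.obj) →L[ℂ] R.obj (X.obj ⊗ Y.obj)) : Prop :=
  ∀ (z : R.obj (X.obj ⊗ Y.obj)) (l : R.obj L),
    R.map ((α_ X.obj Y.obj L).hom ≫ X.obj ◁ (β_ Y.obj L).hom ≫ starMorphism X Y ≫
      X.obj ◁ (β_ Y.obj L).inv ≫ (α_ X.obj Y.obj L).inv) (R.tmul (X.obj ⊗ Y.obj) L z l) =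
    R.tmul (X.obj ⊗ Y.obj) L (T z) l

theorem IsStarProduct.isStarOperator (R : FibreFunctor.{w} C) {X Y : YD F}
    {W : X.obj ⊗ Y.obj ⟶ X.obj ⊗ Y.obj} (h : IsStarProduct X Y W) :
    IsStarOperator R X Y (R.map W) := by
  intro z l
  have e : (α_ X.obj Y.obj L).hom ≫ X.obj ◁ (β_ Y.obj L).hom ≫ starMorphism X Y ≫
      X.obj ◁ (β_ Y.obj L).inv ≫ (α_ X.obj Y.obj L).inv = W ▷ L := by
    rw [← h, over13_eq]
    simp [leg12]
  rw [e, R.map_whiskerRight]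

variable [MonoidalStarCategory C]

instance : StarCategory (YD F) where
  adj {X Y} f := ⟨StarCategory.adj f.hom, by
      have h := congrArg (fun t => Y.U ≫ StarCategory.adj t ≫ X.U) f.comm_U
      simp only [StarCategory.adj_comp, MonoidalStarCategory.adj_whiskerRight, Category.assoc] at h
      rw [X.unitary_U.adj_comp, Category.comp_id, reassoc_of% Y.unitary_U.comp_adj] at h
      exact h, by
      have h := congrArg (fun t => Y.V ≫ StarCategory.adj t ≫ X.V) f.comm_V
      simp only [StarCategory.adj_comp, MonoidalStarCategory.adj_whiskerLeft, Category.assoc] at h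
      rw [X.unitary_V.adj_comp, Category.comp_id, reassoc_of% Y.unitary_V.comp_adj] at h
      exact h⟩
  adj_adj f := Hom.ext (StarCategory.adj_adj f.hom)
  adj_comp f g := Hom.ext (StarCategory.adj_comp f.hom g.hom)

variable [UnitarilyBraided C]

/-- The tensor product of Yetter-Drinfeld modules. -/
def tensor (X Y : YD F) : YD F where
  obj := X.obj ⊗ Y.obj
  U := tensorCorep X.U Y.U
  V := tensorRep X.V Y.V
  unitary_U := (MonoidalStarCategory.associator_unitary _ _ _).comp
    ((Y.unitary_U.whiskerLeft _).comp ((X.unitary_U.over13 _).comp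
      (MonoidalStarCategory.associator_unitary _ _ _).inv))
  unitary_V := (X.unitary_V.leg12 _).comp (Y.unitary_V.under13 _)
  isCorep := X.isCorep.tensor Y.isCorep
  isRep := X.isRep.tensor Y.isRep
  isYD := X.isYD.tensor Y.isYD

/-- The unit object. -/
def unit : YD F where
  obj := 𝟙_ C
  U := 𝟙 _
  V := 𝟙 _
  unitary_U := isUnitary_id _
  unitary_V := isUnitary_id _
  isCorep := isCorep_unit
  isRep := isRep_unit
  isYD := isYD_unit

/-- The monoidal category of Yetter-Drinfeld modules. -/
instance : MonoidalCategory (YD F) where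
  tensorObj := tensor
  whiskerLeft X {_ _} f := ⟨X.obj ◁ f.hom, tensorCorep_whiskerLeft _ f.comm_U,
    tensorRep_whiskerLeft _ f.comm_V⟩
  whiskerRight {_ _} f Y := ⟨f.hom ▷ Y.obj, tensorCorep_whiskerRight _ f.comm_U,
    tensorRep_whiskerRight _ f.comm_V⟩
  tensorUnit := unit
  associator X Y Z := isoMk (α_ X.obj Y.obj Z.obj) (tensorCorep_assoc _ _ _)
    (tensorRep_assoc _ _ _)
  leftUnitor X := isoMk (λ_ X.obj) (tensorCorep_leftUnitor _) (tensorRep_leftUnitor _)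
  rightUnitor X := isoMk (ρ_ X.obj) (tensorCorep_rightUnitor _) (tensorRep_rightUnitor _)
  tensorHom_def _ _ := rfl
  id_tensorHom_id X Y := Hom.ext (by
    change 𝟙 X.obj ▷ Y.obj ≫ X.obj ◁ 𝟙 Y.obj = 𝟙 (X.obj ⊗ Y.obj)
    simp)
  tensorHom_comp_tensorHom {X₁ Y₁ Z₁ X₂ Y₂ Z₂} f₁ f₂ g₁ g₂ := Hom.ext (by
    change (f₁.hom ▷ X₂.obj ≫ Y₁.obj ◁ f₂.hom) ≫ g₁.hom ▷ Y₂.obj ≫ Z₁.obj ◁ g₂.hom =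
      (f₁.hom ≫ g₁.hom) ▷ X₂.obj ≫ Z₁.obj ◁ (f₂.hom ≫ g₂.hom)
    simp only [MonoidalCategory.comp_whiskerRight, MonoidalCategory.whiskerLeft_comp,
      Category.assoc]
    rw [whisker_exchange_assoc])
  whiskerLeft_id X Y := Hom.ext (MonoidalCategory.whiskerLeft_id X.obj Y.obj)
  id_whiskerRight X Y := Hom.ext (MonoidalCategory.id_whiskerRight X.obj Y.obj)
  associator_naturality f₁ f₂ f₃ := Hom.ext (by
    have h := MonoidalCategory.associator_naturality f₁.hom f₂.hom f₃.hom
    simp only [MonoidalCategory.tensorHom_def] at h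
    exact h)
  leftUnitor_naturality f := Hom.ext (MonoidalCategory.leftUnitor_naturality f.hom)
  rightUnitor_naturality f := Hom.ext (MonoidalCategory.rightUnitor_naturality f.hom)
  pentagon X Y Z W := Hom.ext (MonoidalCategory.pentagon X.obj Y.obj Z.obj W.obj)
  triangle X Y := Hom.ext (MonoidalCategory.triangle X.obj Y.obj)

/-- The underlying fibre functor on Yetter-Drinfeld modules. -/
def fibre (R : FibreFunctor.{w} C) (F : L ⊗ L ⟶ L ⊗ L) : FibreFunctor.{w} (YD F) where
  obj X := R.obj X.obj
  map f := R.map f.hom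
  map_id X := R.map_id X.obj
  map_comp f g := R.map_comp f.hom g.hom
  map_adj f := R.map_adj f.hom
  tmul X Y := R.tmul X.obj Y.obj
  inner_tmul := R.inner_tmul
  span_tmul X Y := R.span_tmul X.obj Y.obj
  map_whiskerLeft X {_ _} f := R.map_whiskerLeft X.obj f.hom
  map_whiskerRight {_ _} f Z := R.map_whiskerRight f.hom Z.obj
  one := R.one
  norm_one := R.norm_one
  span_one := R.span_one
  map_associator X Y Z := R.map_associator X.obj Y.obj Z.obj
  map_leftUnitor X := R.map_leftUnitor X.obj
  map_rightUnitor X := R.map_rightUnitor X.obj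

/-! ### The braiding `Φ` -/

/-- The braiding `Φ` of the Yetter-Drinfeld category: `Φ_{H,K} = c_{K,H}⁻¹ ∘ (V_K ∗ U_H)`, with
`V_K ∗ U_H` unitary. -/
def IsYDBraiding (Φ : BraidedCategory (YD F)) : Prop :=
  ∀ X Y : YD F, ∃ W : X.obj ⊗ Y.obj ⟶ X.obj ⊗ Y.obj, IsUnitary W ∧ IsStarProduct X Y W ∧
    (Φ.braiding X Y).hom.hom = W ≫ (β_ Y.obj X.obj).inv

/-- The operator `c_{K,H}⁻¹ ∘ T` from the Hilbert space of `H ⊗ K` to that of `K ⊗ H`. -/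
def braidOperator (R : FibreFunctor.{w} C) (X Y : YD F)
    (T : R.obj (X.obj ⊗ Y.obj) →L[ℂ] R.obj (X.obj ⊗ Y.obj)) :
    R.obj (X.obj ⊗ Y.obj) →L[ℂ] R.obj (Y.obj ⊗ X.obj) :=
  (R.map (β_ Y.obj X.obj).inv).comp T

end YD

end MU

end

end BraidedMU

/-!
Write `X = U₁₂* V₂₃ U₁₂ V₂₃*` on `H ⊗ L ⊗ K`, for a corepresentation `U` on `H` and a representation
`V` on `K`. Conjugation by `F₂₃` turns `U₁₂` into `U₁₂ U₁₃`, and conjugation by `F₂₃*` turns `V₃₄`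
into `V₂₄ V₃₄`; together this gives `F₂₃ X₁₂₄ = X₁₃₄ F₂₃` on `H ⊗ L ⊗ L ⊗ K`. Once the leg `L` is
moved to the right by the braiding, it says that `X₁₂` commutes with `(c⁻¹ F)₂₃` (`starMorR_comm`), so
`X` commutes with the slices of `c⁻¹ F` on the leg `L`. By semi-regularity of `F` these include all
compact operators, so `X = T ⊗ id` with `T = V ∗ U` (`exists_isStarOp`); `T` is unique and unitary
since `X` is unitary and the Hilbert space of `L` is nonzero.

The slices of an operator span the same closed space as its slices by vector functionals
(`FibreFunctor.slices_le`). Tensor `Φ = c⁻¹ (V ∗ U)` with `id_L`, replace `(V ∗ U) ⊗ id` by `X`, and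
pull `c⁻¹` through by naturality. Unitaries on the sliced legs do not matter, and there remains the
product `(c⁻¹ V)₁₂ (c⁻¹)₂₃ (c⁻¹ U)₁₂` (`IsStarOp.slices_eq`). Hence the slices of `Φ` are generated by
the operators `(id ⊗ ⟨l'|) c⁻¹V (id ⊗ S) c⁻¹U (id ⊗ |l⟩)` with `S` a slice of `c⁻¹`. For `S` of rank one
this is a product of a slice of `c⁻¹ V` and a slice of `c⁻¹ U`; so these products are slices of `Φ` if
`c` is semi-regular, and generate all of them if `c` is regular. The case `V = F` has `V ∗ U = U`: the
slices of `c⁻¹ U` then absorb those of `c⁻¹ F`, in particular the compact operators on `L`, and as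
slices of unitaries are nondegenerate they contain all compact operators from `H` to `L`
(`compacts_le_slices_corep`). The same step for `c⁻¹ V` gives the claim for `Φ`; in the regular case
every product involves a compact slice of `c⁻¹ F`, whence the reverse inclusion.

For the braiding, `W = V ∗ U` is characterised by `V₂₃ U₁₂ = U₁₂ W₁₃ V₂₃` (`Exchange`). If the fibre
functor is faithful, identities involving `W` may be checked with an additional strand `L` behind
them. Conjugating the Yetter-Drinfeld equations of `K` by `U₁₂` and of `H` by `V₃₄` shows that `c⁻¹ W`
is a morphism of Yetter-Drinfeld modules (`Exchange.comm_corep`, `Exchange.comm_rep`), and the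
behaviour of `W` under tensor products (`Exchange.tensor_left`, `Exchange.tensor_right`) gives the
hexagons.
-/

namespace BraidedMU

noncomputable section

/-! ### Compact operators and Hilbert space tensor products -/

section Hilbert

variable {E G : Type*} [NormedAddCommGroup E] [InnerProductSpace ℂ E] [CompleteSpace E]
  [NormedAddCommGroup G] [InnerProductSpace ℂ G] [CompleteSpace G]

theorem isCompactOperator_rankOne {E G : Type*} [NormedAddCommGroup E] [InnerProductSpace ℂ E]
    [NormedAddCommGroup G] [InnerProductSpace ℂ G] (x : G) (y : E) :
    IsCompactOperator (InnerProductSpace.rankOne ℂ x y : E →L[ℂ] G) := by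
  rw [InnerProductSpace.rankOne_def']
  exact (isCompactOperator_of_locallyCompactSpace_rng
    (ContinuousLinearMap.toSpanSingleton ℂ x)).comp_clm (innerSL ℂ y)

/-- In a Hilbert space the range of a compact operator is, up to `ε` on the unit ball, contained in
the span of a finite net, so projecting onto that span gives an approximation of finite rank. -/
theorem compactOperator_le_of_rankOne_mem {M : Submodule ℂ (E →L[ℂ] G)}
    (hM : IsClosed (M : Set (E →L[ℂ] G)))
    (h : ∀ (x : G) (y : E), InnerProductSpace.rankOne ℂ x y ∈ M) :
    compactOperator (RingHom.id ℂ) E G ≤ M := by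
  intro T hT
  change IsCompactOperator T at hT
  have hcl : T ∈ closure (M : Set (E →L[ℂ] G)) := by
    rw [Metric.mem_closure_iff]
    intro ε hε
    have hc := hT.isCompact_closure_image_ball (f := (T : E →ₗ[ℂ] G)) 2
    obtain ⟨t, htf, ht⟩ := Metric.totallyBounded_iff.1
      (hc.totallyBounded.subset subset_closure) (ε / 2) (half_pos hε)
    let S : Submodule ℂ G := Submodule.span ℂ t
    have : FiniteDimensional ℂ S := FiniteDimensional.span_of_finite ℂ htf
    let e := stdOrthonormalBasis ℂ S
    let P : E →L[ℂ] G := ∑ i, InnerProductSpace.rankOne ℂ (e i : G)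
      (ContinuousLinearMap.adjoint T (e i : G))
    have hP : ∀ z, P z = S.starProjection (T z) := by
      intro z
      have := e.sum_repr (S.orthogonalProjectionOnto (T z))
      rw [Submodule.starProjection_apply, ← this]
      simp [P, ContinuousLinearMap.adjoint_inner_left,
        OrthonormalBasis.repr_apply_apply]
    refine ⟨P, M.sum_mem fun i _ => h _ _, ?_⟩
    rw [dist_eq_norm]
    refine lt_of_le_of_lt ?_ (half_lt_self hε)
    refine ContinuousLinearMap.opNorm_le_of_unit_norm (by positivity) fun z hz => ?_
    obtain ⟨y, hyt, hy⟩ := Set.mem_iUnion₂.1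
      (ht ⟨z, by simp [hz], rfl⟩ : T z ∈ ⋃ y ∈ t, Metric.ball y (ε / 2))
    rw [sub_apply, hP, Submodule.starProjection_minimal]
    refine (ciInf_le ⟨0, ?_⟩ (⟨y, Submodule.subset_span hyt⟩ : S)).trans ?_
    · rintro _ ⟨x, rfl⟩
      positivity
    · rw [Metric.mem_ball, dist_eq_norm] at hy
      exact hy.le
  rwa [hM.closure_eq] at hcl

/-- The space of operators whose adjoints lie in `M`. -/
def adjointComap (M : Submodule ℂ (G →L[ℂ] E)) : Submodule ℂ (E →L[ℂ] G) :=
  M.comap (ContinuousLinearMap.adjoint : (E →L[ℂ] G) ≃ₗᵢ⋆[ℂ] (G →L[ℂ] E)).toLinearEquiv.toLinearMap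

theorem mem_adjointComap {M : Submodule ℂ (G →L[ℂ] E)} {T : E →L[ℂ] G} :
    T ∈ adjointComap M ↔ ContinuousLinearMap.adjoint T ∈ M := Iff.rfl

theorem isClosed_adjointComap {M : Submodule ℂ (G →L[ℂ] E)}
    (hM : IsClosed (M : Set (G →L[ℂ] E))) : IsClosed (adjointComap M : Set (E →L[ℂ] G)) :=
  hM.preimage (ContinuousLinearMap.adjoint : (E →L[ℂ] G) ≃ₗᵢ⋆[ℂ] (G →L[ℂ] E)).continuous

theorem isClosed_compactOperator {E G : Type*} [NormedAddCommGroup E] [InnerProductSpace ℂ E]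
    [NormedAddCommGroup G] [InnerProductSpace ℂ G] [CompleteSpace G] :
    IsClosed (compactOperator (RingHom.id ℂ) E G : Set (E →L[ℂ] G)) :=
  isClosed_setOfPred_isCompactOperator

theorem adjoint_mem_compactOperator {T : E →L[ℂ] G} (hT : T ∈ compactOperator (RingHom.id ℂ) E G) :
    ContinuousLinearMap.adjoint T ∈ compactOperator (RingHom.id ℂ) G E := by
  have h : compactOperator (RingHom.id ℂ) E G ≤
      adjointComap (compactOperator (RingHom.id ℂ) G E) :=
    compactOperator_le_of_rankOne_mem (isClosed_adjointComap isClosed_compactOperator)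
      fun x y => by
        rw [mem_adjointComap, InnerProductSpace.adjoint_rankOne]
        exact isCompactOperator_rankOne y x
  exact h hT

/-- Every element of an algebraic tensor product of inner product spaces has the form
`∑ eᵢ ⊗ yᵢ` with an orthonormal family `e`. -/
theorem exists_orthonormal_sum_tmul {E₁ E₂ : Type*} [NormedAddCommGroup E₁]
    [InnerProductSpace ℂ E₁] [NormedAddCommGroup E₂] [InnerProductSpace ℂ E₂]
    (t : TensorProduct ℂ E₁ E₂) : ∃ (n : ℕ) (e : Fin n → E₁) (y : Fin n → E₂), Orthonormal ℂ e ∧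
      t = ∑ i, TensorProduct.tmul ℂ (e i) (y i) := by
  obtain ⟨S, hS, ht⟩ := TensorProduct.exists_finite_submodule_left_of_setFinite {t}
    (Set.finite_singleton t)
  obtain ⟨s, rfl⟩ := Set.singleton_subset_iff.mp ht
  let b := stdOrthonormalBasis ℂ S
  refine ⟨_, fun i => (b i : E₁), ?_⟩
  have h : ∃ y : Fin (Module.finrank ℂ S) → E₂, s = ∑ i, TensorProduct.tmul ℂ (b i) (y i) := by
    induction s with
    | zero => exact ⟨0, by simp⟩
    | tmul x z =>
      refine ⟨fun i => b.repr x i • z, ?_⟩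
      conv_lhs => rw [← b.sum_repr x]
      simp [TensorProduct.sum_tmul, TensorProduct.smul_tmul]
    | add s₁ s₂ h₁ h₂ =>
      obtain ⟨y₁, rfl⟩ := h₁ (by simp)
      obtain ⟨y₂, rfl⟩ := h₂ (by simp)
      exact ⟨y₁ + y₂, by simp [TensorProduct.tmul_add, Finset.sum_add_distrib]⟩
  obtain ⟨y, rfl⟩ := h
  exact ⟨y, b.orthonormal.comp_linearIsometry S.subtypeₗᵢ, by simp⟩

end Hilbert

/-! ### Operators on the tensor products of a fibre functor -/

namespace FibreFunctor

variable {C : Type u} [Category.{v} C] [MonoidalCategory C] [StarCategory C]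
  (R : FibreFunctor.{w} C)

/-- Closed conditions on vectors of `R.obj (X ⊗ Y)` that are stable under linear combinations need
only be checked on elementary tensors. -/
theorem tmul_induction {X Y : C} {p : R.obj (X ⊗ Y) → Prop} (hp : IsClosed {z | p z})
    (h0 : p 0) (hadd : ∀ z w, p z → p w → p (z + w)) (hsmul : ∀ (a : ℂ) z, p z → p (a • z))
    (h : ∀ x y, p (R.tmul X Y x y)) (z : R.obj (X ⊗ Y)) : p z := by
  let S : Submodule ℂ (R.obj (X ⊗ Y)) :=
    { carrier := {z | p z}, add_mem' := hadd _ _, zero_mem' := h0, smul_mem' := hsmul }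
  have h1 := Submodule.topologicalClosure_minimal (t := S)
    (Submodule.span ℂ {z | ∃ x y, R.tmul X Y x y = z}) (Submodule.span_le.2 (by rintro _ ⟨x, y, rfl⟩; exact h x y)) hp
  rw [R.span_tmul] at h1
  exact h1 (Submodule.mem_top : z ∈ ⊤)

variable {R}

theorem tmul_ext {X Y : C} {E : Type*} [NormedAddCommGroup E] [NormedSpace ℂ E]
    {S T : R.obj (X ⊗ Y) →L[ℂ] E} (h : ∀ x y, S (R.tmul X Y x y) = T (R.tmul X Y x y)) :
    S = T := by
  ext z
  refine R.tmul_induction (p := fun z => S z = T z) (isClosed_eq S.continuous T.continuous)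
    (by simp) ?_ ?_ h z
  · intro z w hz hw
    simp [hz, hw]
  · intro a z hz
    simp [hz]

theorem eq_of_inner_tmul {X Y : C} {z w : R.obj (X ⊗ Y)}
    (h : ∀ x y, ⟪R.tmul X Y x y, z⟫_ℂ = ⟪R.tmul X Y x y, w⟫_ℂ) : z = w := by
  have h1 : innerSL ℂ z = innerSL ℂ w := tmul_ext fun x y => by
    simpa using congrArg (starRingEnd ℂ) (h x y)
  refine ext_inner_right ℂ fun v => ?_
  simpa using DFunLike.congr_fun h1 v

theorem inner_map_right {X Y : C} (f : X ⟶ Y) (x : R.obj X) (y : R.obj Y) :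
    ⟪y, R.map f x⟫_ℂ = ⟪R.map (StarCategory.adj f) y, x⟫_ℂ := by
  rw [R.map_adj, ContinuousLinearMap.adjoint_inner_left]

theorem map_comp_apply {X Y Z : C} (f : X ⟶ Y) (g : Y ⟶ Z) (x : R.obj X) :
    R.map (f ≫ g) x = R.map g (R.map f x) := by
  rw [R.map_comp, ContinuousLinearMap.comp_apply]

theorem map_id_apply (X : C) (x : R.obj X) : R.map (𝟙 X) x = x := by
  rw [R.map_id, ContinuousLinearMap.id_apply]

theorem map_inv_map_hom {X Y : C} (e : X ≅ Y) (x : R.obj X) :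
    R.map e.inv (R.map e.hom x) = x := by
  rw [← map_comp_apply, e.hom_inv_id, map_id_apply]

theorem map_associator_inv (X Y Z : C) (x : R.obj X) (y : R.obj Y) (z : R.obj Z) :
    R.map (α_ X Y Z).inv (R.tmul X (Y ⊗ Z) x (R.tmul Y Z y z)) =
      R.tmul (X ⊗ Y) Z (R.tmul X Y x y) z := by
  rw [← R.map_associator, ← map_comp_apply, Iso.hom_inv_id, map_id_apply]

theorem map_whiskerRight_apply {X Y : C} (f : X ⟶ Y) (Z : C) (z : R.obj Z) (x : R.obj X) :
    R.map (f ▷ Z) ((R.tmul X Z).flip z x) = (R.tmul Y Z).flip z (R.map f x) :=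
  R.map_whiskerRight f Z x z

variable (R)

/-- The algebraic tensor product as a dense subspace of `R.obj (X ⊗ Y)`. -/
def ofTensor (X Y : C) : TensorProduct ℂ (R.obj X) (R.obj Y) →ₗ[ℂ] R.obj (X ⊗ Y) :=
  TensorProduct.lift (ContinuousLinearMap.toLinearMap₁₂ (R.tmul X Y))

@[simp]
theorem ofTensor_tmul {X Y : C} (x : R.obj X) (y : R.obj Y) :
    R.ofTensor X Y (TensorProduct.tmul ℂ x y) = R.tmul X Y x y := rfl

theorem denseRange_ofTensor (X Y : C) : DenseRange (R.ofTensor X Y) := by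
  intro z
  refine R.tmul_induction (p := fun z => z ∈ (LinearMap.range (R.ofTensor X Y)).topologicalClosure)
    (Submodule.isClosed_topologicalClosure _) (Submodule.zero_mem _)
    (fun _ _ => Submodule.add_mem _) (fun a _ => Submodule.smul_mem _ a) ?_ z
  intro x y
  exact Submodule.le_topologicalClosure _ ⟨TensorProduct.tmul ℂ x y, rfl⟩

theorem norm_sq_sum_tmul (X Y : C) {n : ℕ} {e : Fin n → R.obj X} (he : Orthonormal ℂ e)
    (y : Fin n → R.obj Y) : ‖∑ i, R.tmul X Y (e i) (y i)‖ ^ 2 = ∑ i, ‖y i‖ ^ 2 := by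
  have h {E : Type w} [NormedAddCommGroup E] [InnerProductSpace ℂ E] (v : E) :
      (‖v‖ : ℂ) ^ 2 = ⟪v, v⟫_ℂ := (inner_self_eq_norm_sq_to_K v).symm
  rw [← Complex.ofReal_inj]
  push_cast
  simp only [h, sum_inner, inner_sum, R.inner_tmul, orthonormal_iff_ite.1 he]
  simp

/-- In a representation `∑ eᵢ ⊗ yᵢ` with orthonormal `e` the squared norm is `∑ ‖yᵢ‖²`, whence
`id ⊗ S` is bounded by `‖S‖` on algebraic tensors. -/
theorem norm_ofTensor_lTensor_le (X : C) {Y Y' : C} (S : R.obj Y →L[ℂ] R.obj Y')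
    (t : TensorProduct ℂ (R.obj X) (R.obj Y)) :
    ‖(R.ofTensor X Y' ∘ₗ LinearMap.lTensor (R.obj X) (S : R.obj Y →ₗ[ℂ] R.obj Y')) t‖ ≤
      ‖S‖ * ‖R.ofTensor X Y t‖ := by
  obtain ⟨n, e, y, he, rfl⟩ := exists_orthonormal_sum_tmul t
  refine le_of_sq_le_sq ?_ (by positivity)
  simp only [map_sum, LinearMap.comp_apply, LinearMap.lTensor_tmul, ofTensor_tmul, mul_pow,
    R.norm_sq_sum_tmul X _ he, ContinuousLinearMap.coe_coe, Finset.mul_sum]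
  refine Finset.sum_le_sum fun i _ => ?_
  rw [← mul_pow]
  gcongr
  exact S.le_opNorm _

/-- The operator `id ⊗ S` for a single bounded operator `S`, extended by continuity from the
algebraic tensor product; see `amp`. -/
def ampAux (X : C) {Y Y' : C} (S : R.obj Y →L[ℂ] R.obj Y') :
    R.obj (X ⊗ Y) →L[ℂ] R.obj (X ⊗ Y') :=
  (R.ofTensor X Y' ∘ₗ LinearMap.lTensor (R.obj X) (S : R.obj Y →ₗ[ℂ] R.obj Y')).extendOfNorm
    (R.ofTensor X Y)

@[simp]
theorem ampAux_tmul (X : C) {Y Y' : C} (S : R.obj Y →L[ℂ] R.obj Y') (x : R.obj X)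
    (y : R.obj Y) : R.ampAux X S (R.tmul X Y x y) = R.tmul X Y' x (S y) :=
  LinearMap.extendOfNorm_eq (R.denseRange_ofTensor X Y) ⟨_, R.norm_ofTensor_lTensor_le X S⟩
    (TensorProduct.tmul ℂ x y)

/-- The operator `id ⊗ S` on Hilbert space tensor products, for an arbitrary bounded operator `S`,
as a bounded linear function of `S`. -/
def amp (X : C) {Y Y' : C} :
    (R.obj Y →L[ℂ] R.obj Y') →L[ℂ] R.obj (X ⊗ Y) →L[ℂ] R.obj (X ⊗ Y') :=
  LinearMap.mkContinuous
    { toFun := R.ampAux X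
      map_add' := fun S T => tmul_ext fun x y => by simp
      map_smul' := fun a S => tmul_ext fun x y => by simp } 1 fun S => by
    rw [one_mul]
    exact ContinuousLinearMap.opNorm_le_bound _ (norm_nonneg _)
      (LinearMap.norm_extendOfNorm_apply_le (R.denseRange_ofTensor X Y) _
        (R.norm_ofTensor_lTensor_le X S))

@[simp]
theorem amp_tmul (X : C) {Y Y' : C} (S : R.obj Y →L[ℂ] R.obj Y') (x : R.obj X) (y : R.obj Y) :
    R.amp X S (R.tmul X Y x y) = R.tmul X Y' x (S y) :=
  R.ampAux_tmul X S x y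

/-- The slice `(id ⊗ ⟨η|) T (id ⊗ |ξ⟩)` of an operator on tensor products. -/
def sliceAt {X Y X' Y' : C} (T : R.obj (X ⊗ Y) →L[ℂ] R.obj (X' ⊗ Y')) (ξ : R.obj Y)
    (η : R.obj Y') : R.obj X →L[ℂ] R.obj X' :=
  (ContinuousLinearMap.adjoint ((R.tmul X' Y').flip η)).comp (T.comp ((R.tmul X Y).flip ξ))

theorem inner_sliceAt {X Y X' Y' : C} (T : R.obj (X ⊗ Y) →L[ℂ] R.obj (X' ⊗ Y')) (ξ : R.obj Y)
    (η : R.obj Y') (x : R.obj X) (x' : R.obj X') :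
    ⟪x', R.sliceAt T ξ η x⟫_ℂ = ⟪R.tmul X' Y' x' η, T (R.tmul X Y x ξ)⟫_ℂ := by
  simp [sliceAt, ContinuousLinearMap.adjoint_inner_right]


variable {R}

theorem sliceAt_add_left {X Y X' Y' : C} (T : R.obj (X ⊗ Y) →L[ℂ] R.obj (X' ⊗ Y'))
    (ξ ξ' : R.obj Y) (η : R.obj Y') :
    R.sliceAt T (ξ + ξ') η = R.sliceAt T ξ η + R.sliceAt T ξ' η := by
  ext x
  simp [sliceAt]

theorem sliceAt_smul_left {X Y X' Y' : C} (T : R.obj (X ⊗ Y) →L[ℂ] R.obj (X' ⊗ Y'))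
    (a : ℂ) (ξ : R.obj Y) (η : R.obj Y') :
    R.sliceAt T (a • ξ) η = a • R.sliceAt T ξ η := by
  ext x
  simp [sliceAt]

theorem sliceAt_add_right {X Y X' Y' : C} (T : R.obj (X ⊗ Y) →L[ℂ] R.obj (X' ⊗ Y'))
    (ξ : R.obj Y) (η η' : R.obj Y') :
    R.sliceAt T ξ (η + η') = R.sliceAt T ξ η + R.sliceAt T ξ η' := by
  ext x
  simp [sliceAt]

theorem sliceAt_smul_right {X Y X' Y' : C} (T : R.obj (X ⊗ Y) →L[ℂ] R.obj (X' ⊗ Y'))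
    (a : ℂ) (ξ : R.obj Y) (η : R.obj Y') :
    R.sliceAt T ξ (a • η) = starRingEnd ℂ a • R.sliceAt T ξ η := by
  ext x
  refine ext_inner_left ℂ fun x' => ?_
  simp [inner_sliceAt, inner_smul_right]
  ring

theorem continuous_sliceAt_left {X Y X' Y' : C} (T : R.obj (X ⊗ Y) →L[ℂ] R.obj (X' ⊗ Y'))
    (η : R.obj Y') : Continuous fun ξ => R.sliceAt T ξ η :=
  ((ContinuousLinearMap.compL ℂ _ _ _ (ContinuousLinearMap.adjoint ((R.tmul X' Y').flip η))).comp
    ((ContinuousLinearMap.compL ℂ _ _ _ T).comp (R.tmul X Y).flip)).continuous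

theorem continuous_sliceAt_right {X Y X' Y' : C} (T : R.obj (X ⊗ Y) →L[ℂ] R.obj (X' ⊗ Y'))
    (ξ : R.obj Y) : Continuous fun η => R.sliceAt T ξ η := by
  unfold sliceAt
  exact (ContinuousLinearMap.adjoint.continuous.comp
    (R.tmul X' Y').flip.continuous).clm_comp continuous_const

theorem sliceAt_mem_slices {X Y X' Y' : C} (T : R.obj (X ⊗ Y) →L[ℂ] R.obj (X' ⊗ Y'))
    (ξ : R.obj Y) (η : R.obj Y') : R.sliceAt T ξ η ∈ R.slices T := by
  refine Submodule.le_topologicalClosure _ (Submodule.subset_span ?_)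
  refine ⟨(innerSL ℂ η).comp (ContinuousLinearMap.apply ℂ (R.obj Y') ξ),
    Submodule.le_topologicalClosure _ (Submodule.subset_span ⟨ξ, η, fun _ => rfl⟩), ?_⟩
  intro x x'
  rw [inner_sliceAt]
  simp [ContinuousLinearMap.adjoint_inner_right]

theorem isClosed_slices {X Y X' Y' : C} (T : R.obj (X ⊗ Y) →L[ℂ] R.obj (X' ⊗ Y')) :
    IsClosed (R.slices T : Set (R.obj X →L[ℂ] R.obj X')) :=
  Submodule.isClosed_topologicalClosure _

/-- Every normal functional is a norm limit of combinations of vector functionals, so the slices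
by vector functionals already span. -/
theorem slices_le {X Y X' Y' : C} {T : R.obj (X ⊗ Y) →L[ℂ] R.obj (X' ⊗ Y')}
    {M : Submodule ℂ (R.obj X →L[ℂ] R.obj X')} (hM : IsClosed (M : Set (R.obj X →L[ℂ] R.obj X')))
    (h : ∀ ξ η, R.sliceAt T ξ η ∈ M) : R.slices T ≤ M := by
  refine Submodule.topologicalClosure_minimal _ (Submodule.span_le.2 ?_) hM
  rintro S ⟨φ, hφ, hS⟩
  have key : ∀ ψ ∈ Submodule.span ℂ {φ : StrongDual ℂ (R.obj Y →L[ℂ] R.obj Y') |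
      ∃ (ξ : R.obj Y) (η : R.obj Y'), ∀ T : R.obj Y →L[ℂ] R.obj Y', φ T = ⟪η, T ξ⟫_ℂ},
      ∃ S' ∈ M, ∀ (x : R.obj X) (x' : R.obj X'), ⟪x', S' x⟫_ℂ =
        ψ ((ContinuousLinearMap.adjoint (R.tmul X' Y' x')).comp (T.comp (R.tmul X Y x))) := by
    intro ψ hψ
    induction hψ using Submodule.span_induction with
    | mem ψ hψ =>
      obtain ⟨ξ, η, hψ⟩ := hψ
      refine ⟨_, h ξ η, fun x x' => ?_⟩
      rw [hψ, inner_sliceAt]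
      simp [ContinuousLinearMap.adjoint_inner_right]
    | zero => exact ⟨0, M.zero_mem, by simp⟩
    | add ψ₁ ψ₂ _ _ h₁ h₂ =>
      obtain ⟨S₁, h₁, h₁'⟩ := h₁
      obtain ⟨S₂, h₂, h₂'⟩ := h₂
      exact ⟨S₁ + S₂, M.add_mem h₁ h₂, fun x x' => by simp [h₁', h₂']⟩
    | smul a ψ _ h₁ =>
      obtain ⟨S₁, h₁, h₁'⟩ := h₁
      exact ⟨a • S₁, M.smul_mem a h₁, fun x x' => by simp [h₁']⟩
  have hb : ∃ K : ℝ, 0 < K ∧ ∀ (x : R.obj X) (x' : R.obj X'),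
      ‖(ContinuousLinearMap.adjoint (R.tmul X' Y' x')).comp (T.comp (R.tmul X Y x))‖ ≤
        K * ‖x‖ * ‖x'‖ := by
    refine ⟨‖R.tmul X' Y'‖ * (‖T‖ * ‖R.tmul X Y‖) + 1, by positivity, fun x x' => ?_⟩
    calc _ ≤ ‖R.tmul X' Y' x'‖ * (‖T‖ * ‖R.tmul X Y x‖) := by
          refine (ContinuousLinearMap.opNorm_comp_le _ _).trans ?_
          rw [LinearIsometryEquiv.norm_map]
          gcongr
          exact ContinuousLinearMap.opNorm_comp_le _ _
      _ ≤ (‖R.tmul X' Y'‖ * ‖x'‖) * (‖T‖ * (‖R.tmul X Y‖ * ‖x‖)) := by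
          gcongr <;> exact ContinuousLinearMap.le_opNorm _ _
      _ = (‖R.tmul X' Y'‖ * (‖T‖ * ‖R.tmul X Y‖)) * ‖x‖ * ‖x'‖ := by ring
      _ ≤ _ := by gcongr; linarith
  obtain ⟨K, hK, hb⟩ := hb
  have hcl : S ∈ closure (M : Set (R.obj X →L[ℂ] R.obj X')) := by
    rw [Metric.mem_closure_iff]
    intro ε hε
    obtain ⟨ψ, hψ, hd⟩ := (Metric.mem_closure_iff
      (α := StrongDual ℂ (R.obj Y →L[ℂ] R.obj Y'))).1 hφ (ε / (2 * K)) (by positivity)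
    obtain ⟨S', hS', hS''⟩ := key ψ hψ
    refine ⟨S', hS', ?_⟩
    have hd' : ‖φ - ψ‖ < ε / (2 * K) := (dist_eq_norm φ ψ).symm.trans_lt hd
    rw [dist_eq_norm]
    refine lt_of_le_of_lt ?_ (half_lt_self hε)
    refine ContinuousLinearMap.opNorm_le_bound _ (by positivity) fun x => ?_
    -- test `S - S'` against its own values
    obtain ⟨v, hv⟩ : ∃ v : R.obj X', v = (S - S') x := ⟨_, rfl⟩
    have h1 : ∀ u, ⟪u, v⟫_ℂ = (φ - ψ)
        ((ContinuousLinearMap.adjoint (R.tmul X' Y' u)).comp (T.comp (R.tmul X Y x))) := by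
      intro u
      rw [hv, sub_apply, inner_sub_right, hS, hS'', sub_apply]
    have h2 : ‖v‖ * ‖v‖ ≤ (ε / 2 * ‖x‖) * ‖v‖ := by
      have h3 : ‖v‖ * ‖v‖ = ‖⟪v, v⟫_ℂ‖ := by
        rw [inner_self_eq_norm_sq_to_K]
        simp [sq]
      rw [h3, h1]
      calc _ ≤ ‖φ - ψ‖ * (K * ‖x‖ * ‖v‖) :=
            (ContinuousLinearMap.le_opNorm _ _).trans (by gcongr; exact hb x v)
        _ ≤ (ε / (2 * K)) * (K * ‖x‖ * ‖v‖) := by gcongr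
        _ = _ := by field_simp
    rw [← hv]
    rcases (norm_nonneg v).eq_or_lt with h0 | h0
    · rw [← h0]
      positivity
    · exact le_of_mul_le_mul_right h2 h0
  rwa [hM.closure_eq] at hcl

theorem sliceAt_mem_of_tmul {X X' Y Z Y' Z' : C}
    {T : R.obj (X ⊗ Y ⊗ Z) →L[ℂ] R.obj (X' ⊗ Y' ⊗ Z')}
    {M : Submodule ℂ (R.obj X →L[ℂ] R.obj X')} (hM : IsClosed (M : Set (R.obj X →L[ℂ] R.obj X')))
    (h : ∀ y z y' z', R.sliceAt T (R.tmul Y Z y z) (R.tmul Y' Z' y' z') ∈ M)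
    (ξ : R.obj (Y ⊗ Z)) (η : R.obj (Y' ⊗ Z')) : R.sliceAt T ξ η ∈ M := by
  refine R.tmul_induction (p := fun ξ => R.sliceAt T ξ η ∈ M)
    (hM.preimage (continuous_sliceAt_left T η)) (by simp [sliceAt, M.zero_mem])
    (fun ξ ξ' h h' => by rw [sliceAt_add_left]; exact M.add_mem h h')
    (fun a ξ h => by rw [sliceAt_smul_left]; exact M.smul_mem _ h) (fun y z => ?_) ξ
  exact R.tmul_induction (p := fun η => R.sliceAt T _ η ∈ M)
    (hM.preimage (continuous_sliceAt_right T _)) (by simp [sliceAt, M.zero_mem])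
    (fun η η' h h' => by rw [sliceAt_add_right]; exact M.add_mem h h')
    (fun a η h => by rw [sliceAt_smul_right]; exact M.smul_mem _ h) (h y z) η

theorem sliceAt_adjoint {X Y X' Y' : C} (T : R.obj (X ⊗ Y) →L[ℂ] R.obj (X' ⊗ Y'))
    (ξ : R.obj Y) (η : R.obj Y') :
    R.sliceAt (ContinuousLinearMap.adjoint T) η ξ = ContinuousLinearMap.adjoint (R.sliceAt T ξ η) := by
  simp [sliceAt, ContinuousLinearMap.adjoint_comp, ContinuousLinearMap.comp_assoc]

theorem amp_rankOne (L : C) {H K : C} (k : R.obj K) (h : R.obj H) :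
    R.amp L (InnerProductSpace.rankOne ℂ k h) =
      ((R.tmul L K).flip k).comp (ContinuousLinearMap.adjoint ((R.tmul L H).flip h)) := by
  refine tmul_ext fun a b => ?_
  rw [amp_tmul, InnerProductSpace.rankOne_apply, ContinuousLinearMap.comp_apply]
  have e : ContinuousLinearMap.adjoint ((R.tmul L H).flip h) (R.tmul L H a b) = ⟪h, b⟫_ℂ • a := by
    refine ext_inner_left ℂ fun c => ?_
    rw [ContinuousLinearMap.adjoint_inner_right, ContinuousLinearMap.flip_apply, R.inner_tmul,
      inner_smul_right, mul_comm]
  rw [e]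
  simp

/-- The vectors in the ranges of the slices of a unitary span a dense subspace: slicing the image
of `x' ⊗ η` under the inverse gives a nonzero multiple of `x'`. -/
theorem mem_of_sliceAt_mem {X Y X' Y' : C} [Nontrivial (R.obj Y')] {G : X ⊗ Y ⟶ X' ⊗ Y'}
    (hG : IsUnitary G) {M : Submodule ℂ (R.obj X')} (hM : IsClosed (M : Set (R.obj X')))
    (h : ∀ ξ η x, R.sliceAt (R.map G) ξ η x ∈ M) (x' : R.obj X') : x' ∈ M := by
  obtain ⟨η, hη⟩ := exists_ne (0 : R.obj Y')
  let A := ContinuousLinearMap.adjoint ((R.tmul X' Y').flip η)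
  have h1 : ∀ w, A (R.map G w) ∈ M := fun w =>
    R.tmul_induction (p := fun w => A (R.map G w) ∈ M)
      (hM.preimage (A.comp (R.map G)).continuous) (by simp)
      (fun z w hz hw => by rw [map_add, map_add]; exact M.add_mem hz hw)
      (fun a z hz => by rw [map_smul, map_smul]; exact M.smul_mem a hz)
      (fun x ξ => h ξ η x) w
  have h2 := h1 (R.map (StarCategory.adj G) (R.tmul X' Y' x' η))
  rw [← map_comp_apply, hG.adj_comp, map_id_apply] at h2
  have e : A (R.tmul X' Y' x' η) = ⟪η, η⟫_ℂ • x' := by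
    refine ext_inner_left ℂ fun c => ?_
    rw [ContinuousLinearMap.adjoint_inner_right, ContinuousLinearMap.flip_apply, R.inner_tmul,
      inner_smul_right, mul_comm]
  rw [e] at h2
  exact (M.smul_mem_iff (inner_self_ne_zero.2 hη)).1 h2

/-- The composite `r₁₂ q₂₃ p₁₂ : H ⊗ L ⊗ K → L ⊗ H ⊗ K → L ⊗ K ⊗ H → K ⊗ L ⊗ H`. -/
def interleave {H L K : C} (p : H ⊗ L ⟶ L ⊗ H) (q : H ⊗ K ⟶ K ⊗ H) (r : L ⊗ K ⟶ K ⊗ L) :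
    H ⊗ L ⊗ K ⟶ K ⊗ L ⊗ H :=
  leg12 p K ≫ L ◁ q ≫ leg12 r H

variable (R) in
/-- The bounded linear map `S ↦ (id ⊗ ⟨l'|) r (id ⊗ S) p (id ⊗ |l⟩)`. -/
def sandwich {H L K : C} (p : H ⊗ L ⟶ L ⊗ H) (r : L ⊗ K ⟶ K ⊗ L) (l l' : R.obj L) :
    (R.obj H →L[ℂ] R.obj K) →L[ℂ] R.obj H →L[ℂ] R.obj K :=
  (ContinuousLinearMap.compL ℂ _ _ _
      ((ContinuousLinearMap.adjoint ((R.tmul K L).flip l')).comp (R.map r))).comp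
    (((ContinuousLinearMap.compL ℂ _ _ _).flip ((R.map p).comp ((R.tmul H L).flip l))).comp
      (R.amp L))

theorem sandwich_apply {H L K : C} (p : H ⊗ L ⟶ L ⊗ H) (r : L ⊗ K ⟶ K ⊗ L) (l l' : R.obj L)
    (S : R.obj H →L[ℂ] R.obj K) : R.sandwich p r l l' S =
      ((ContinuousLinearMap.adjoint ((R.tmul K L).flip l')).comp (R.map r)).comp
        ((R.amp L S).comp ((R.map p).comp ((R.tmul H L).flip l))) := by
  ext x
  simp [sandwich]

theorem sandwich_rankOne {H L K : C} (p : H ⊗ L ⟶ L ⊗ H) (r : L ⊗ K ⟶ K ⊗ L) (l l' : R.obj L)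
    (k : R.obj K) (h : R.obj H) : R.sandwich p r l l' (InnerProductSpace.rankOne ℂ k h) =
      (R.sliceAt (R.map r) k l').comp (R.sliceAt (R.map p) l h) := by
  rw [sandwich_apply, amp_rankOne, sliceAt, sliceAt]
  simp only [ContinuousLinearMap.comp_assoc]

variable [MonoidalStarCategory C]

theorem inner_map_associator_inv {X Y Z : C} (z : R.obj ((X ⊗ Y) ⊗ Z)) (w : R.obj (X ⊗ Y ⊗ Z)) :
    ⟪z, R.map (α_ X Y Z).inv w⟫_ℂ = ⟪R.map (α_ X Y Z).hom z, w⟫_ℂ := by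
  rw [inner_map_right, (MonoidalStarCategory.associator_unitary X Y Z).inv_eq,
    StarCategory.adj_adj]

/-- Composition with operators on the sliced leg only changes the vectors by which one slices. -/
theorem sliceAt_whiskerLeft {X Y₀ Y X' Y' Y₀' : C} (a : Y₀ ⟶ Y) (f : X ⊗ Y ⟶ X' ⊗ Y')
    (b : Y' ⟶ Y₀') (ξ : R.obj Y₀) (η : R.obj Y₀') :
    R.sliceAt (R.map (X ◁ a ≫ f ≫ X' ◁ b)) ξ η =
      R.sliceAt (R.map f) (R.map a ξ) (R.map (StarCategory.adj b) η) := by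
  ext x
  refine ext_inner_left ℂ fun x' => ?_
  rw [inner_sliceAt, inner_sliceAt, map_comp_apply, map_comp_apply, R.map_whiskerLeft,
    inner_map_right (X' ◁ b), MonoidalStarCategory.adj_whiskerLeft, R.map_whiskerLeft]

/-- Slicing the last leg of `q₂₃` gives `id ⊗ S`, where `S` is the slice of `q`. -/
theorem amp_sliceAt (L : C) {H K K' H' : C} (q : H ⊗ K ⟶ K' ⊗ H') (k : R.obj K) (h : R.obj H') :
    R.amp L (R.sliceAt (R.map q) k h) =
      (ContinuousLinearMap.adjoint ((R.tmul (L ⊗ K') H').flip h)).comp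
        ((R.map ((α_ L H K).hom ≫ L ◁ q ≫ (α_ L K' H').inv)).comp ((R.tmul (L ⊗ H) K).flip k)) := by
  refine tmul_ext fun a b => eq_of_inner_tmul fun c d => ?_
  rw [amp_tmul, R.inner_tmul, inner_sliceAt]
  simp only [ContinuousLinearMap.comp_apply, ContinuousLinearMap.adjoint_inner_right,
    ContinuousLinearMap.flip_apply]
  rw [map_comp_apply, map_comp_apply, R.map_associator, R.map_whiskerLeft,
    inner_map_associator_inv, R.map_associator, R.inner_tmul]

/-- The slices of `r₁₂ q₂₃ p₁₂` at elementary tensors depend on `q` only through its slices. -/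
theorem sliceAt_interleave {H L K : C} (p : H ⊗ L ⟶ L ⊗ H) (q : H ⊗ K ⟶ K ⊗ H)
    (r : L ⊗ K ⟶ K ⊗ L) (l l' : R.obj L) (k : R.obj K) (h : R.obj H) :
    R.sliceAt (R.map (interleave p q r)) (R.tmul L K l k) (R.tmul L H l' h) =
      R.sandwich p r l l' (R.sliceAt (R.map q) k h) := by
  ext x
  refine ext_inner_left ℂ fun y => ?_
  rw [inner_sliceAt, sandwich_apply, amp_sliceAt]
  simp only [ContinuousLinearMap.comp_apply, ContinuousLinearMap.adjoint_inner_right,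
    ContinuousLinearMap.flip_apply, inner_map_right r]
  simp only [interleave, leg12, map_comp_apply, map_associator_inv, R.map_whiskerRight]
  rw [← R.map_associator, inner_map_right (α_ K L H).hom,
    ← (MonoidalStarCategory.associator_unitary K L H).inv_eq, map_inv_map_hom,
    inner_map_right (r ▷ H), MonoidalStarCategory.adj_whiskerRight,
    R.map_whiskerRight]

/-- If all slices of `q` are compact, they are approximated by operators of finite rank, and for
`S` of rank one `sandwich p r l l' S` is the product of a slice of `r` and a slice of `p`. -/
theorem slices_interleave_le {H L K : C} (p : H ⊗ L ⟶ L ⊗ H) {q : H ⊗ K ⟶ K ⊗ H}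
    (r : L ⊗ K ⟶ K ⊗ L) (hq : R.slices (R.map q) ≤ R.compacts H K)
    {M : Submodule ℂ (R.obj H →L[ℂ] R.obj K)} (hM : IsClosed (M : Set (R.obj H →L[ℂ] R.obj K)))
    (h : ∀ k l' l h, (R.sliceAt (R.map r) k l').comp (R.sliceAt (R.map p) l h) ∈ M) :
    R.slices (R.map (interleave p q r)) ≤ M := by
  refine slices_le hM (sliceAt_mem_of_tmul hM fun l k l' x => ?_)
  rw [sliceAt_interleave]
  have hle : R.compacts H K ≤ M.comap (R.sandwich p r l l').toLinearMap :=
    compactOperator_le_of_rankOne_mem (hM.preimage (R.sandwich p r l l').continuous) fun k x => by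
      change R.sandwich p r l l' _ ∈ M
      rw [sandwich_rankOne]
      exact h _ _ _ _
  exact hle (hq (sliceAt_mem_slices _ _ _))

/-- If every compact operator is a slice of `q`, then the products of slices of `r` and of `p` are
slices of `r₁₂ q₂₃ p₁₂`. -/
theorem mem_slices_interleave {H L K : C} (p : H ⊗ L ⟶ L ⊗ H) {q : H ⊗ K ⟶ K ⊗ H}
    (r : L ⊗ K ⟶ K ⊗ L) (hq : R.compacts H K ≤ R.slices (R.map q)) (k : R.obj K) (l' l : R.obj L)
    (h : R.obj H) : (R.sliceAt (R.map r) k l').comp (R.sliceAt (R.map p) l h) ∈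
      R.slices (R.map (interleave p q r)) := by
  have hle : R.slices (R.map q) ≤
      (R.slices (R.map (interleave p q r))).comap (R.sandwich p r l l').toLinearMap :=
    slices_le ((isClosed_slices _).preimage (R.sandwich p r l l').continuous) fun ξ η => by
      change R.sandwich p r l l' (R.sliceAt (R.map q) ξ η) ∈ R.slices (R.map (interleave p q r))
      rw [← sliceAt_interleave]
      exact sliceAt_mem_slices _ _ _
  rw [← sandwich_rankOne]
  exact hle (hq (isCompactOperator_rankOne k h))

end FibreFunctor

/-! ### The exchange relation `V₂₃ U₁₂ = U₁₂ W₁₃ V₂₃` -/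

section Exchange

variable {C : Type u} [Category.{v} C] [MonoidalCategory C] [BraidedCategory C]

/-- The exchange relation `V₂₃ U₁₂ = U₁₂ W₁₃ V₂₃` on `H ⊗ L ⊗ K`, i.e. `W = V ∗ U`. The
corepresentation and representation equations of `F` are the cases `V = F`, `W = U` and `U = F`,
`W = V`. -/
def Exchange {H L K : C} (U : H ⊗ L ⟶ H ⊗ L) (V : L ⊗ K ⟶ L ⊗ K) (W : H ⊗ K ⟶ H ⊗ K) : Prop :=
  leg12 U K ≫ H ◁ V = H ◁ V ≫ over13 W L ≫ leg12 U K

variable {L : C}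

/-- The line of `f` from leg 1 to leg 3 passes in front of leg 2, and the line of `g` from leg 2 to
leg 4 behind leg 3, so the two commute. -/
theorem over13_leg12_comm {X Y A B : C} (f : X ⊗ A ⟶ X ⊗ A) (g : Y ⊗ B ⟶ Y ⊗ B) :
    over13 (leg12 f B) Y ≫ X ◁ under13 g A = X ◁ under13 g A ≫ over13 (leg12 f B) Y := by
  have t := congrArg (fun t => leg12 (β_ X Y).hom (A ⊗ B) ≫ t ≫ leg12 (β_ X Y).inv (A ⊗ B))
    (leg_comm₂ g f)
  rw [under13.eq_1 (under13 g A : Y ⊗ (A ⊗ B) ⟶ Y ⊗ (A ⊗ B)) X] at t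
  simp only [Category.assoc, leg12_hom_inv, Category.comp_id, leg12_hom_inv_assoc] at t
  simpa only [over13, Category.assoc] using t

theorem under13_leg12_comm {X Y A B : C} (f : X ⊗ A ⟶ X ⊗ A) (g : Y ⊗ B ⟶ Y ⊗ B) :
    under13 (leg12 f B) Y ≫ X ◁ over13 g A = X ◁ over13 g A ≫ under13 (leg12 f B) Y :=
  @over13_leg12_comm C _ _ (reverseBraiding C) X Y A B f g

section

variable {H K : C} {U : H ⊗ L ⟶ H ⊗ L} {V : L ⊗ K ⟶ L ⊗ K} {W : H ⊗ K ⟶ H ⊗ K}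

theorem Exchange.leg12_right (h : Exchange U V W) (B : C) :
    leg12 U (K ⊗ B) ≫ H ◁ leg12 V B = H ◁ leg12 V B ≫ over13 (leg12 W B) L ≫ leg12 U (K ⊗ B) := by
  have e := congrArg (fun t => H ◁ (α_ _ _ _).inv ≫ leg12 t B ≫ H ◁ (α_ _ _ _).hom) h
  simp only [leg12_comp, leg12_over13, leg12_whiskerLeft] at e
  rw [leg12_tensor]
  simp [leg12] at e ⊢
  exact e

theorem Exchange.under13_right (h : Exchange U V W) (A : C) :
    leg12 U (A ⊗ K) ≫ H ◁ under13 V A =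
      H ◁ under13 V A ≫ over13 (under13 W A) L ≫ leg12 U (A ⊗ K) := by
  have e := h.leg12_right A
  rw [under13_eq, under13_eq, over13_comp, over13_comp, over13_whiskerLeft, over13_whiskerLeft]
  simp only [MonoidalCategory.whiskerLeft_comp, Category.assoc]
  rw [← leg12_natural, reassoc_of% (leg12_natural U (β_ A K).hom), reassoc_of% e]
  simp

theorem Exchange.over13_right (h : Exchange U V W) (A : C) :
    leg12 U (A ⊗ K) ≫ H ◁ over13 V A =
      H ◁ over13 V A ≫ over13 (over13 W A) L ≫ leg12 U (A ⊗ K) := by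
  have e := h.leg12_right A
  rw [over13_eq V, over13_eq W, over13_comp, over13_comp, over13_whiskerLeft, over13_whiskerLeft]
  simp only [MonoidalCategory.whiskerLeft_comp, Category.assoc]
  rw [← leg12_natural, reassoc_of% (leg12_natural U (β_ K A).inv), reassoc_of% e]
  simp

end

/-- `V ∗ (U₁ ⊗ U₂) = (V ∗ U₁)₁₃ (V ∗ U₂)₂₃`. -/
theorem Exchange.tensor_left {A B K : C} {U₁ : A ⊗ L ⟶ A ⊗ L} {U₂ : B ⊗ L ⟶ B ⊗ L}
    {V : L ⊗ K ⟶ L ⊗ K} {W₁ : A ⊗ K ⟶ A ⊗ K} {W₂ : B ⊗ K ⟶ B ⊗ K}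
    (h₁ : Exchange U₁ V W₁) (h₂ : Exchange U₂ V W₂) :
    Exchange (tensorCorep U₁ U₂) V
      ((α_ A B K).hom ≫ A ◁ W₂ ≫ over13 W₁ B ≫ (α_ A B K).inv) := by
  have e₁ := congrArg (fun t => over13 t B) h₁
  have e₂ := congrArg (fun t => A ◁ t) h₂
  simp only [over13_comp, over13_whiskerLeft, MonoidalCategory.whiskerLeft_comp] at e₁ e₂
  have e := over13_tensorCorep (L := K) W₁ W₂ L
  rw [tensorCorep] at e
  rw [Exchange, leg12_tensorCorep, e]
  simp only [tensor_whiskerLeft, Category.assoc, Iso.inv_hom_id_assoc]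
  rw [reassoc_of% e₁, reassoc_of% e₂, ← reassoc_of% (leg_comm₁ W₁ U₂)]

/-- `(V₁ ⊗ V₂) ∗ U = (V₂ ∗ U)'₁₃ (V₁ ∗ U)₁₂`. -/
theorem Exchange.tensor_right {A H B : C} {U : H ⊗ L ⟶ H ⊗ L} {V₁ : L ⊗ A ⟶ L ⊗ A}
    {V₂ : L ⊗ B ⟶ L ⊗ B} {W₁ : H ⊗ A ⟶ H ⊗ A} {W₂ : H ⊗ B ⟶ H ⊗ B}
    (h₁ : Exchange U V₁ W₁) (h₂ : Exchange U V₂ W₂) :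
    Exchange U (tensorRep V₁ V₂) (leg12 W₁ B ≫ under13 W₂ A) := by
  have e₁ := h₁.leg12_right B
  have e₂ := h₂.under13_right A
  simp only [Exchange, tensorRep, MonoidalCategory.whiskerLeft_comp, over13_comp, Category.assoc]
  rw [reassoc_of% e₁, e₂, reassoc_of% (over13_leg12_comm W₁ V₂)]

instance isIso_leg12 {X Y X' Y' : C} (f : X ⊗ Y ⟶ X' ⊗ Y') [IsIso f] (Z : C) :
    IsIso (leg12 f Z) := by
  unfold leg12
  infer_instance

instance isIso_over13 {X Z X' Z' : C} (f : X ⊗ Z ⟶ X' ⊗ Z') [IsIso f] (Y : C) :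
    IsIso (over13 f Y) := by
  unfold over13
  infer_instance

instance isIso_under13 {X Z X' Z' : C} (f : X ⊗ Z ⟶ X' ⊗ Z') [IsIso f] (Y : C) :
    IsIso (under13 f Y) := by
  unfold under13
  infer_instance

theorem whiskerRight_eq_of_over13_eq {X Z X' Z' Y : C} {f g : X ⊗ Z ⟶ X' ⊗ Z'}
    (h : over13 f Y = over13 g Y) : f ▷ Y = g ▷ Y := by
  rwa [over13_eq, over13_eq, cancel_epi, cancel_mono, leg12, leg12, cancel_epi, cancel_mono] at h

/-- The Yetter-Drinfeld equation of `K`, conjugated by `U₁₂` on `H ⊗ L ⊗ K ⊗ L`, gives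
`W₁₂ U₁₃ U'₂₃ = U'₂₃ U'₁₃ W₁₂` (where `U'₁₃` is `under13 U K`) on `H ⊗ K ⊗ L` with a strand `L` behind. -/
theorem Exchange.comm_corep {H K : C} {F : L ⊗ L ⟶ L ⊗ L} {U : H ⊗ L ⟶ H ⊗ L}
    {V : L ⊗ K ⟶ L ⊗ K} {U' : K ⊗ L ⟶ K ⊗ L} {W : H ⊗ K ⟶ H ⊗ K} [IsIso F] [IsIso V] [IsIso U]
    (h : Exchange U V W) (hU : IsCorep F U) (hY : IsYD F U' V) :
    (H ◁ U' ≫ over13 U K ≫ leg12 W L) ▷ L = (leg12 W L ≫ under13 U K ≫ H ◁ U') ▷ L := by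
  -- the corepresentation equation is itself an exchange relation
  have hU' : Exchange U F U := hU
  have e₁ := congrArg (fun t => H ◁ t) hY
  simp only [MonoidalCategory.whiskerLeft_comp] at e₁
  have e₂ := h.leg12_right L
  have e₃ := hU'.over13_right K
  have e₃' := hU'.under13_right K
  have e₄ := leg_comm₁ U V
  have e₅ := over13_leg12_comm W F
  have e₆ := leg12_natural U U'
  have key : over13 (H ◁ U' ≫ over13 U K ≫ leg12 W L) L =
      over13 (leg12 W L ≫ under13 U K ≫ H ◁ U') L := by
    rw [over13_comp, over13_comp, over13_comp, over13_comp, over13_whiskerLeft,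
      ← cancel_epi (H ◁ leg12 V L ≫ H ◁ under13 F K), ← cancel_mono (leg12 U (K ⊗ L))]
    simp only [Category.assoc]
    rw [← reassoc_of% e₁, ← reassoc_of% e₅, ← e₆, ← reassoc_of% e₃', ← reassoc_of% e₂, ← e₁,
      reassoc_of% e₄, ← e₂, ← reassoc_of% e₃, ← reassoc_of% e₆]
  exact whiskerRight_eq_of_over13_eq key

/-- The Yetter-Drinfeld equation of `H`, conjugated by `V₃₄` on `L ⊗ H ⊗ L ⊗ K`, gives
`W₂₃ V'₁₃ V'₁₂ = V'₁₂ V₁₃ W₂₃` (where `V'₁₃` is `under13 V H`) on `L ⊗ H ⊗ K` with a strand `L` behind. -/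
theorem Exchange.comm_rep {H K : C} {F : L ⊗ L ⟶ L ⊗ L} {U : H ⊗ L ⟶ H ⊗ L}
    {V : L ⊗ K ⟶ L ⊗ K} {V' : L ⊗ H ⟶ L ⊗ H} {W : H ⊗ K ⟶ H ⊗ K} [IsIso F] [IsIso V] [IsIso U]
    (h : Exchange U V W) (hV : IsRep F V) (hY : IsYD F U V') :
    (leg12 V' K ≫ under13 V H ≫ L ◁ W) ▷ L = (L ◁ W ≫ over13 V H ≫ leg12 V' K) ▷ L := by
  have e₁ : L ◁ leg12 U K ≫ over13 (leg12 F K) H ≫ leg12 V' (L ⊗ K) =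
      leg12 V' (L ⊗ K) ≫ under13 (leg12 F K) H ≫ L ◁ leg12 U K := by
    have e := congrArg (fun t => L ◁ (α_ _ _ _).inv ≫ leg12 t K ≫ L ◁ (α_ _ _ _).hom) hY
    simp only [leg12_comp, leg12_over13, leg12_under13, leg12_whiskerLeft] at e
    rw [leg12_tensor]
    simp [leg12] at e ⊢
    exact e
  have a₁ := congrArg (fun t => over13 t H) hV
  have a₂ := congrArg (fun t => under13 t H) hV
  have a₃ := congrArg (fun t => L ◁ t) h
  simp only [over13_comp, over13_whiskerLeft] at a₁
  simp only [under13_comp, under13_whiskerLeft] at a₂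
  simp only [MonoidalCategory.whiskerLeft_comp] at a₃
  have a₄ := leg_comm₁ V U
  have a₅ := under13_leg12_comm F W
  have a₆ := leg12_natural V' V
  have key : leg12 V' (L ⊗ K) ≫ under13 (over13 V L) H ≫ L ◁ over13 W L =
      L ◁ over13 W L ≫ over13 (over13 V L) H ≫ leg12 V' (L ⊗ K) := by
    rw [← cancel_epi (L ◁ H ◁ V), ← cancel_mono (under13 (leg12 F K) H ≫ L ◁ leg12 U K)]
    simp only [Category.assoc]
    rw [← reassoc_of% a₅, ← reassoc_of% a₆, ← reassoc_of% a₂, ← a₃, ← e₁, ← reassoc_of% a₄,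
      ← reassoc_of% a₃, ← reassoc_of% a₁, ← a₆, reassoc_of% e₁]
  have b₁ : leg12 V' (L ⊗ K) = (L ◁ H ◁ (β_ K L).inv ≫ L ◁ (α_ H K L).inv) ≫
      leg12 (leg12 V' K) L ≫ L ◁ (α_ H K L).hom ≫ L ◁ H ◁ (β_ K L).hom := by
    have t := leg12_tensor V' K L
    rw [Category.assoc, ← reassoc_of% t, leg12_natural, ← MonoidalCategory.whiskerLeft_comp_assoc,
      ← MonoidalCategory.whiskerLeft_comp, Iso.inv_hom_id]
    simp
  have b₂ : under13 (over13 V L) H = (L ◁ H ◁ (β_ K L).inv ≫ L ◁ (α_ H K L).inv) ≫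
      leg12 (under13 V H) L ≫ L ◁ (α_ H K L).hom ≫ L ◁ H ◁ (β_ K L).hom := by
    simp [over13_eq V L, leg12_under13, under13_comp, under13_whiskerLeft]
  have b₃ : over13 (over13 V L) H = (L ◁ H ◁ (β_ K L).inv ≫ L ◁ (α_ H K L).inv) ≫
      leg12 (over13 V H) L ≫ L ◁ (α_ H K L).hom ≫ L ◁ H ◁ (β_ K L).hom := by
    simp [over13_eq V L, leg12_over13, over13_comp, over13_whiskerLeft]
  have b₄ : L ◁ over13 W L = (L ◁ H ◁ (β_ K L).inv ≫ L ◁ (α_ H K L).inv) ≫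
      leg12 (L ◁ W) L ≫ L ◁ (α_ H K L).hom ≫ L ◁ H ◁ (β_ K L).hom := by
    simp [over13_eq W L, leg12]
  have b : (L ◁ (α_ H K L).hom ≫ L ◁ H ◁ (β_ K L).hom) ≫
      (L ◁ H ◁ (β_ K L).inv ≫ L ◁ (α_ H K L).inv) = 𝟙 _ := by
    simp
  rw [b₁, b₂, b₃, b₄] at key
  simp only [Category.assoc] at key b
  simp only [reassoc_of% b, cancel_epi] at key
  simp only [← Category.assoc, cancel_mono] at key
  simp only [← leg12_comp] at key
  simpa [leg12, -comp_whiskerRight] using key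

end Exchange

/-! ### The morphism `U₁₂* V₂₃ U₁₂ V₂₃*` -/

section Star

variable {C : Type u} [Category.{v} C] [MonoidalCategory C] [BraidedCategory C]

/-- A strand `H` can be pulled past `g` along the inverse braiding. -/
theorem whiskerLeft_slide {A B A' B' : C} (g : A ⊗ B ⟶ A' ⊗ B') (H : C) :
    H ◁ g ≫ leg12 (β_ A' H).inv B' =
      leg12 (β_ A H).inv B ≫ A ◁ (β_ B H).inv ≫ leg12 g H ≫ A' ◁ (β_ B' H).hom := by
  have h := congrArg (fun t => leg12 (β_ A H).inv B ≫ t) (over13_eq g H)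
  simp only [over13] at h
  rw [← h, reassoc_of% (leg12_inv_hom (β_ A H) B)]

/-- The operator `X₁₃₄` on `H ⊗ M ⊗ L ⊗ K`, for `X` on `H ⊗ L ⊗ K` with the leg `L` moved to the
right. -/
theorem over13_conj_braiding {H L K M : C} (X : H ⊗ L ⊗ K ⟶ H ⊗ L ⊗ K) :
    over13 ((α_ H K L).hom ≫ H ◁ (β_ K L).hom ≫ X ≫ H ◁ (β_ K L).inv ≫ (α_ H K L).inv) M =
     (α_ H K (M ⊗ L)).hom ≫ H ◁ leg12 (β_ K M).hom L ≫ H ◁ M ◁ (β_ K L).hom ≫ over13 X M ≫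
      H ◁ M ◁ (β_ K L).inv ≫ H ◁ leg12 (β_ K M).inv L ≫ (α_ H K (M ⊗ L)).inv := by
  have h : over13 (H ◁ (β_ K L).hom ≫ X ≫ H ◁ (β_ K L).inv) M = H ◁ M ◁ (β_ K L).hom ≫ over13 X M ≫
      H ◁ M ◁ (β_ K L).inv := by rw [over13_comp, over13_comp, over13_whiskerLeft, over13_whiskerLeft]
  rw [← reassoc_of% h]
  simp [over13, leg12]

theorem whiskerLeft_comp_braiding {H K A B A' B' : C} (g : A ⊗ B ⟶ A' ⊗ B') :
    (H ⊗ K) ◁ g ≫ (α_ H K (A' ⊗ B')).hom ≫ H ◁ leg12 (β_ K A').hom B' ≫ H ◁ A' ◁ (β_ K B').hom =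
      ((α_ H K (A ⊗ B)).hom ≫ H ◁ leg12 (β_ K A).hom B ≫ H ◁ A ◁ (β_ K B).hom) ≫
        H ◁ leg12 g K := by
  have h := congrArg (fun t => H ◁ (leg12 (β_ K A).hom B ≫ t ≫ A' ◁ (β_ K B').hom))
    (under13_eq g K)
  simp only [under13, Category.assoc, leg12_hom_inv_assoc, whiskerLeft_inv_hom,
    Category.comp_id] at h
  simp only [Category.assoc, tensor_whiskerLeft, Iso.inv_hom_id_assoc]
  simp only [← MonoidalCategory.whiskerLeft_comp]
  rw [h]

variable [StarCategory C]

/-- The morphism `U₁₂* V₂₃ U₁₂ V₂₃*` on `H ⊗ L ⊗ K`, for arbitrary `U` and `V`. -/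
def starMor {H L K : C} (U : H ⊗ L ⟶ H ⊗ L) (V : L ⊗ K ⟶ L ⊗ K) : H ⊗ L ⊗ K ⟶ H ⊗ L ⊗ K :=
  H ◁ StarCategory.adj V ≫ leg12 U K ≫ H ◁ V ≫ leg12 (StarCategory.adj U) K

/-- The morphism `U₁₂* V₂₃ U₁₂ V₂₃*` with the leg `L` moved to the right by the braiding. -/
def starMorR {H L K : C} (U : H ⊗ L ⟶ H ⊗ L) (V : L ⊗ K ⟶ L ⊗ K) :
    (H ⊗ K) ⊗ L ⟶ (H ⊗ K) ⊗ L :=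
  (α_ H K L).hom ≫ H ◁ (β_ K L).hom ≫ starMor U V ≫ H ◁ (β_ K L).inv ≫ (α_ H K L).inv

/-- Naturality of the braiding moves `c_{K,H}⁻¹` through `U₁₂* V₂₃ U₁₂ V₂₃*`: up to unitaries on the
last two legs, what remains is the interleaved product of `c⁻¹ U`, `c⁻¹` and `c⁻¹ V`. -/
theorem starMorR_braiding {H L K : C} (U : H ⊗ L ⟶ H ⊗ L) (V : L ⊗ K ⟶ L ⊗ K) :
    (α_ H K L).inv ≫ (starMorR U V ≫ (β_ K H).inv ▷ L) ≫ (α_ K H L).hom =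
      H ◁ ((β_ K L).hom ≫ StarCategory.adj V) ≫
        FibreFunctor.interleave (U ≫ (β_ L H).inv) (β_ K H).inv (V ≫ (β_ K L).inv) ≫
          K ◁ ((β_ L H).hom ≫ StarCategory.adj U) := by
  have h1 := under13_eq (StarCategory.adj U) K
  have h2 := whiskerLeft_slide (V ≫ (β_ K L).inv) H
  have e : (starMorR U V ≫ (β_ K H).inv ▷ L) ≫ (α_ K H L).hom = (α_ H K L).hom ≫
      H ◁ (β_ K L).hom ≫ starMor U V ≫ H ◁ (β_ K L).inv ≫ leg12 (β_ K H).inv L := by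
    simp [starMorR, leg12]
  have h3 : leg12 (StarCategory.adj U) K ≫ H ◁ (β_ K L).inv ≫ leg12 (β_ K H).inv L =
      H ◁ (β_ K L).inv ≫ leg12 (β_ K H).inv L ≫ K ◁ StarCategory.adj U := by
    have h := congrArg (fun t => H ◁ (β_ K L).inv ≫ t ≫ leg12 (β_ K H).inv L) h1
    simp only [under13, Category.assoc, leg12_hom_inv, Category.comp_id,
      whiskerLeft_inv_hom_assoc] at h
    exact h.symm
  have h4 : H ◁ V ≫ H ◁ (β_ K L).inv ≫ leg12 (β_ K H).inv L =
      leg12 (β_ L H).inv K ≫ L ◁ (β_ K H).inv ≫ leg12 (V ≫ (β_ K L).inv) H ≫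
        K ◁ (β_ L H).hom := by
    rw [← h2, MonoidalCategory.whiskerLeft_comp, Category.assoc]
  rw [e, Iso.inv_hom_id_assoc, starMor]
  simp only [Category.assoc]
  rw [h3, reassoc_of% h4]
  simp only [FibreFunctor.interleave, leg12_comp, MonoidalCategory.whiskerLeft_comp,
    Category.assoc]

/-- The operator `X₁₂₄` on `H ⊗ L ⊗ M ⊗ K`, in terms of `U` and `V`, for `X = U₁₂* V₂₃ U₁₂ V₂₃*`. -/
theorem leg12_starMorR {H L K : C} (U : H ⊗ L ⟶ H ⊗ L) (V : L ⊗ K ⟶ L ⊗ K) (M : C) :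
    leg12 (starMorR U V) M ≫ (α_ H K (L ⊗ M)).hom ≫ H ◁ leg12 (β_ K L).hom M ≫
        H ◁ L ◁ (β_ K M).hom =
      ((α_ H K (L ⊗ M)).hom ≫ H ◁ leg12 (β_ K L).hom M ≫ H ◁ L ◁ (β_ K M).hom) ≫
        H ◁ over13 (StarCategory.adj V) M ≫ leg12 U (M ⊗ K) ≫ H ◁ over13 V M ≫
          leg12 (StarCategory.adj U) (M ⊗ K) := by
  have h1 : leg12 (starMorR U V) M = (α_ H K (L ⊗ M)).hom ≫ H ◁ leg12 (β_ K L).hom M ≫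
      H ◁ leg12 (StarCategory.adj V) M ≫ leg12 U (K ⊗ M) ≫ H ◁ leg12 V M ≫
        leg12 (StarCategory.adj U) (K ⊗ M) ≫ H ◁ leg12 (β_ K L).inv M ≫
          (α_ H K (L ⊗ M)).inv := by
    simp [starMorR, starMor, leg12]
  have h2 : ∀ T : L ⊗ K ⟶ L ⊗ K, H ◁ leg12 T M ≫ H ◁ L ◁ (β_ K M).hom =
      H ◁ L ◁ (β_ K M).hom ≫ H ◁ over13 T M := by
    intro T
    rw [over13_eq]
    simp
  rw [h1]
  simp only [Category.assoc, Iso.inv_hom_id_assoc]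
  rw [← reassoc_of% (h2 (StarCategory.adj V)), ← reassoc_of% (leg12_natural U (β_ K M).hom),
    ← reassoc_of% (h2 V), ← leg12_natural]
  simp only [← MonoidalCategory.whiskerLeft_comp_assoc, leg12_inv_hom]
  simp

/-- `F₂₃ X₁₂₄ = X₁₃₄ F₂₃` for `X = U₁₂* V₂₃ U₁₂ V₂₃*`: conjugation by `F₂₃` turns `U₁₂` into
`U₁₂ U₁₃`, and conjugation by `F₂₃*` turns `V₃₄` into `V₂₄ V₃₄`. -/
theorem starMor_comp_leg12 {H L K : C} {F : L ⊗ L ⟶ L ⊗ L} {U : H ⊗ L ⟶ H ⊗ L}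
    {V : L ⊗ K ⟶ L ⊗ K} (hU : IsUnitary U) (hV : IsUnitary V) (hcU : IsCorep F U)
    (hrV : IsRep F V) :
    (H ◁ over13 (StarCategory.adj V) L ≫ leg12 U (L ⊗ K) ≫ H ◁ over13 V L ≫
        leg12 (StarCategory.adj U) (L ⊗ K)) ≫ H ◁ leg12 F K =
      H ◁ leg12 F K ≫ over13 (starMor U V) L := by
  have a1 : over13 (leg12 U K) L ≫ over13 (leg12 (StarCategory.adj U) K) L = 𝟙 _ := by
    rw [← over13_comp, ← leg12_comp, hU.comp_adj, leg12_id, over13_id]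
  have a2 : leg12 U (L ⊗ K) ≫ leg12 (StarCategory.adj U) (L ⊗ K) = 𝟙 _ := by
    rw [← leg12_comp, hU.comp_adj, leg12_id]
  have a3 : leg12 (StarCategory.adj U) (L ⊗ K) ≫ leg12 U (L ⊗ K) = 𝟙 _ := by
    rw [← leg12_comp, hU.adj_comp, leg12_id]
  have a4 : H ◁ over13 (StarCategory.adj V) L ≫ H ◁ over13 V L = 𝟙 _ := by
    rw [← MonoidalCategory.whiskerLeft_comp, ← over13_comp, hV.adj_comp, over13_id,
      MonoidalCategory.whiskerLeft_id]
  have a5 : H ◁ L ◁ StarCategory.adj V ≫ H ◁ L ◁ V = 𝟙 _ := by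
    simp only [← MonoidalCategory.whiskerLeft_comp, hV.adj_comp, MonoidalCategory.whiskerLeft_id]
  have a6 : H ◁ L ◁ V ≫ H ◁ L ◁ StarCategory.adj V = 𝟙 _ := by
    simp only [← MonoidalCategory.whiskerLeft_comp, hV.comp_adj, MonoidalCategory.whiskerLeft_id]
  have hcU' : Exchange U F U := hcU
  have h1 := hcU'.leg12_right K
  have h2 := congrArg (fun t => H ◁ t) hrV
  simp only [MonoidalCategory.whiskerLeft_comp] at h2
  have h3 : leg12 (StarCategory.adj U) (L ⊗ K) ≫ H ◁ leg12 F K =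
      H ◁ leg12 F K ≫ leg12 (StarCategory.adj U) (L ⊗ K) ≫
        over13 (leg12 (StarCategory.adj U) K) L := by
    have := congrArg (fun t => leg12 (StarCategory.adj U) (L ⊗ K) ≫ t ≫
      leg12 (StarCategory.adj U) (L ⊗ K) ≫ over13 (leg12 (StarCategory.adj U) K) L) h1
    simp only [Category.assoc, reassoc_of% a2, reassoc_of% a3, a1, Category.comp_id] at this
    exact this.symm
  have h4 : H ◁ over13 V L ≫ H ◁ leg12 F K =
      H ◁ L ◁ StarCategory.adj V ≫ H ◁ leg12 F K ≫ H ◁ L ◁ V := by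
    rw [h2, reassoc_of% a5]
  have h5 : H ◁ over13 (StarCategory.adj V) L ≫ H ◁ L ◁ StarCategory.adj V ≫ H ◁ leg12 F K =
      H ◁ leg12 F K ≫ H ◁ L ◁ StarCategory.adj V := by
    have := congrArg (fun t => H ◁ over13 (StarCategory.adj V) L ≫ H ◁ L ◁ StarCategory.adj V ≫ t ≫
      H ◁ L ◁ StarCategory.adj V) h2
    simp only [Category.assoc, a6, reassoc_of% a5, reassoc_of% a4, Category.comp_id] at this
    exact this
  have c1 := leg12_natural U (StarCategory.adj V)
  have c2 := leg12_natural (StarCategory.adj U) V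
  simp only [Category.assoc]
  rw [h3, reassoc_of% h4, ← reassoc_of% c2, reassoc_of% c1, reassoc_of% h1, reassoc_of% a2,
    reassoc_of% h5]
  simp only [starMor, over13_comp, over13_whiskerLeft]

/-- With the leg `L` moved to the right, `X = U₁₂* V₂₃ U₁₂ V₂₃*` satisfies
`X₁₂ (c⁻¹ F)₂₃ = (c⁻¹ F)₂₃ X₁₂`, so `X` commutes with the slices of `c⁻¹ F` on its last leg. -/
theorem starMorR_comm {H L K : C} {F : L ⊗ L ⟶ L ⊗ L} {U : H ⊗ L ⟶ H ⊗ L}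
    {V : L ⊗ K ⟶ L ⊗ K} (hU : IsUnitary U) (hV : IsUnitary V) (hcU : IsCorep F U)
    (hrV : IsRep F V) :
    leg12 (starMorR U V) L ≫ (H ⊗ K) ◁ (F ≫ (β_ L L).inv) =
      (H ⊗ K) ◁ (F ≫ (β_ L L).inv) ≫ leg12 (starMorR U V) L := by
  let κ : (H ⊗ K) ⊗ L ⊗ L ≅ H ⊗ L ⊗ L ⊗ K := α_ H K (L ⊗ L) ≪≫
    whiskerLeftIso H ((α_ K L L).symm ≪≫ whiskerRightIso (β_ K L) L ≪≫ α_ L K L) ≪≫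
      whiskerLeftIso H (whiskerLeftIso L (β_ K L))
  have hκ : κ.hom = (α_ H K (L ⊗ L)).hom ≫ H ◁ leg12 (β_ K L).hom L ≫ H ◁ L ◁ (β_ K L).hom := rfl
  have hκ' : κ.inv = H ◁ L ◁ (β_ K L).inv ≫ H ◁ leg12 (β_ K L).inv L ≫ (α_ H K (L ⊗ L)).inv := by
    simp [κ, leg12]
  have h1 := leg12_starMorR U V L
  have h2 := whiskerLeft_comp_braiding (H := H) (K := K) F
  rw [← hκ] at h1 h2
  have h3 : over13 (starMorR U V) L = κ.hom ≫ over13 (starMor U V) L ≫ κ.inv := by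
    rw [starMorR, over13_conj_braiding, hκ, hκ']
    simp only [Category.assoc]
  have h4 : leg12 (starMorR U V) L ≫ (H ⊗ K) ◁ F = (H ⊗ K) ◁ F ≫ over13 (starMorR U V) L := by
    rw [← cancel_mono κ.hom, h3]
    simp only [Category.assoc, Iso.inv_hom_id, Category.comp_id]
    rw [h2, reassoc_of% h1, reassoc_of% h2, ← starMor_comp_leg12 hU hV hcU hrV]
    simp only [Category.assoc]
  rw [MonoidalCategory.whiskerLeft_comp, reassoc_of% h4, over13_eq]
  simp

end Star

/-! ### Existence and slices of `V ∗ U` -/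

namespace FibreFunctor

variable {C : Type u} [Category.{v} C] [MonoidalCategory C] [StarCategory C]
  {R : FibreFunctor.{w} C}

theorem tmul_right_injective {M L : C} {l : R.obj L} (hl : l ≠ 0) :
    Function.Injective fun z => R.tmul M L z l := by
  intro z w h
  refine ext_inner_left ℂ fun x => ?_
  have := congrArg (fun t => ⟪R.tmul M L x l, t⟫_ℂ) h
  simp only [R.inner_tmul] at this
  exact mul_right_cancel₀ (inner_self_ne_zero.2 hl) this

/-- An operator commuting with `id ⊗ S` for all compact `S` has the form `T ⊗ id`; operators `S` of
rank one suffice. -/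
theorem exists_eq_tmul_of_comp_amp {M L : C} [Nontrivial (R.obj L)]
    {E : R.obj (M ⊗ L) →L[ℂ] R.obj (M ⊗ L)}
    (hE : ∀ S ∈ R.compacts L L, E.comp (R.amp M S) = (R.amp M S).comp E) :
    ∃ T : R.obj M →L[ℂ] R.obj M, ∀ z l, E (R.tmul M L z l) = R.tmul M L (T z) l := by
  obtain ⟨m, hm⟩ := exists_norm_eq (R.obj L) zero_le_one
  refine ⟨R.sliceAt E m m, fun z l => ?_⟩
  have h := hE _ (isCompactOperator_rankOne l m)
  have h1 := DFunLike.congr_fun h (R.tmul M L z m)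
  rw [ContinuousLinearMap.comp_apply, amp_tmul, InnerProductSpace.rankOne_apply,
    inner_self_eq_norm_sq_to_K, hm] at h1
  rw [amp_rankOne] at h1
  simpa [sliceAt] using h1

variable [MonoidalStarCategory C]

/-- If `E₁₂` commutes with `G₂₃`, then `E` commutes with `id ⊗ S` for all slices `S` of `G`. -/
theorem comp_amp_of_mem_slices {M L : C} {E : M ⊗ L ⟶ M ⊗ L} {G : L ⊗ L ⟶ L ⊗ L}
    (hEG : leg12 E L ≫ M ◁ G = M ◁ G ≫ leg12 E L) {S : R.obj L →L[ℂ] R.obj L}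
    (hS : S ∈ R.slices (R.map G)) : (R.map E).comp (R.amp M S) = (R.amp M S).comp (R.map E) := by
  let A : (R.obj L →L[ℂ] R.obj L) →L[ℂ] R.obj (M ⊗ L) →L[ℂ] R.obj (M ⊗ L) :=
    (ContinuousLinearMap.compL ℂ _ _ _ (R.map E)).comp (R.amp M)
  let B : (R.obj L →L[ℂ] R.obj L) →L[ℂ] R.obj (M ⊗ L) →L[ℂ] R.obj (M ⊗ L) :=
    ((ContinuousLinearMap.compL ℂ _ _ _).flip (R.map E)).comp (R.amp M)
  have h : R.slices (R.map G) ≤ LinearMap.eqLocus A.toLinearMap B.toLinearMap := by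
    refine slices_le (isClosed_eq A.continuous B.continuous) fun ξ η => ?_
    change (R.map E).comp (R.amp M _) = (R.amp M _).comp (R.map E)
    rw [amp_sliceAt]
    ext u
    refine ext_inner_left ℂ fun w => ?_
    have e : E ▷ L ≫ (α_ M L L).hom ≫ M ◁ G ≫ (α_ M L L).inv =
        ((α_ M L L).hom ≫ M ◁ G ≫ (α_ M L L).inv) ≫ E ▷ L := by
      have := congrArg (fun t => (α_ M L L).hom ≫ t ≫ (α_ M L L).inv) hEG
      simpa [leg12] using this
    rw [ContinuousLinearMap.comp_apply, inner_map_right]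
    simp only [ContinuousLinearMap.comp_apply, ContinuousLinearMap.adjoint_inner_right]
    rw [← map_whiskerRight_apply, ← map_whiskerRight_apply,
      ← map_comp_apply (E ▷ L), e, map_comp_apply _ (E ▷ L), inner_map_right (E ▷ L),
      MonoidalStarCategory.adj_whiskerRight]
  exact h hS

end FibreFunctor

section Star

open FibreFunctor

variable {C : Type u} [Category.{v} C] [MonoidalCategory C] [StarCategory C]
  [BraidedCategory C]

/-- The bounded operator `T` is `V ∗ U`, for arbitrary `U` and `V`. -/
def IsStarOp (R : FibreFunctor.{w} C) {H L K : C} (U : H ⊗ L ⟶ H ⊗ L) (V : L ⊗ K ⟶ L ⊗ K)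
    (T : R.obj (H ⊗ K) →L[ℂ] R.obj (H ⊗ K)) : Prop :=
  ∀ z l, R.map (starMorR U V) (R.tmul (H ⊗ K) L z l) = R.tmul (H ⊗ K) L (T z) l

variable {R : FibreFunctor.{w} C} {H L K : C} {U : H ⊗ L ⟶ H ⊗ L} {V : L ⊗ K ⟶ L ⊗ K}

theorem IsStarOp.unique [Nontrivial (R.obj L)] {T T' : R.obj (H ⊗ K) →L[ℂ] R.obj (H ⊗ K)}
    (h : IsStarOp R U V T) (h' : IsStarOp R U V T') : T = T' := by
  obtain ⟨l, hl⟩ := exists_ne (0 : R.obj L)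
  ext z
  exact tmul_right_injective hl ((h z l).symm.trans (h' z l))

variable [MonoidalStarCategory C]

/-- By semi-regularity of `F`, commuting with the slices of `c⁻¹ F` on the last leg means commuting
with all compact operators there. -/
theorem exists_isStarOp [Nontrivial (R.obj L)] {F : L ⊗ L ⟶ L ⊗ L} (hU : IsUnitary U)
    (hV : IsUnitary V) (hcU : IsCorep F U) (hrV : IsRep F V) (hF : R.SemiregularMU F) :
    ∃ T, IsStarOp R U V T :=
  exists_eq_tmul_of_comp_amp fun _ hS =>
    comp_amp_of_mem_slices (starMorR_comm hU hV hcU hrV) (hF hS)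

variable [UnitarilyBraided C]

theorem isUnitary_starMorR (hU : IsUnitary U) (hV : IsUnitary V) : IsUnitary (starMorR U V) := by
  have hα := MonoidalStarCategory.associator_unitary H K L
  have hβ := UnitarilyBraided.braiding_unitary K L
  exact hα.comp ((hβ.whiskerLeft H).comp (((hV.adj.whiskerLeft H).comp ((hU.leg12 K).comp
    ((hV.whiskerLeft H).comp (hU.adj.leg12 K)))).comp ((hβ.inv.whiskerLeft H).comp hα.inv)))

theorem IsStarOp.mem_unitary [Nontrivial (R.obj L)] {T : R.obj (H ⊗ K) →L[ℂ] R.obj (H ⊗ K)}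
    (h : IsStarOp R U V T) (hU : IsUnitary U) (hV : IsUnitary V) :
    T ∈ unitary (R.obj (H ⊗ K) →L[ℂ] R.obj (H ⊗ K)) := by
  obtain ⟨l, hl⟩ := exists_ne (0 : R.obj L)
  have hE := isUnitary_starMorR hU hV
  have h' : ∀ z l, R.map (StarCategory.adj (starMorR U V)) (R.tmul (H ⊗ K) L z l) =
      R.tmul (H ⊗ K) L (ContinuousLinearMap.adjoint T z) l := by
    intro z l
    refine eq_of_inner_tmul fun x m => ?_
    rw [inner_map_right, StarCategory.adj_adj, h, R.inner_tmul, R.inner_tmul,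
      ContinuousLinearMap.adjoint_inner_right]
  rw [Unitary.mem_iff, ContinuousLinearMap.star_eq_adjoint]
  constructor
  · ext z
    refine tmul_right_injective hl ?_
    simp only [mul_apply_eq_comp, one_apply_eq_self]
    rw [← h', ← h, ← map_comp_apply, hE.comp_adj, map_id_apply]
  · ext z
    refine tmul_right_injective hl ?_
    simp only [mul_apply_eq_comp, one_apply_eq_self]
    rw [← h, ← h', ← map_comp_apply, hE.adj_comp, map_id_apply]

/-- The slices of `c⁻¹ (V ∗ U)` agree with those of the interleaved product of `c⁻¹ U`, `c⁻¹` and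
`c⁻¹ V`: tensoring with `id_L` and composing with unitaries on the sliced legs changes nothing. -/
theorem IsStarOp.slices_eq [Nontrivial (R.obj L)] {T : R.obj (H ⊗ K) →L[ℂ] R.obj (H ⊗ K)}
    (h : IsStarOp R U V T) (hU : IsUnitary U) (hV : IsUnitary V) :
    R.slices ((R.map (β_ K H).inv).comp T) =
      R.slices (R.map (interleave (U ≫ (β_ L H).inv) (β_ K H).inv (V ≫ (β_ K L).inv))) := by
  have ha : IsUnitary ((β_ K L).hom ≫ StarCategory.adj V) :=
    (UnitarilyBraided.braiding_unitary K L).comp hV.adj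
  have hb : IsUnitary ((β_ L H).hom ≫ StarCategory.adj U) :=
    (UnitarilyBraided.braiding_unitary L H).comp hU.adj
  have key := starMorR_braiding U V
  set m := interleave (U ≫ (β_ L H).inv) (β_ K H).inv (V ≫ (β_ K L).inv)
  set a := (β_ K L).hom ≫ StarCategory.adj V
  set b := (β_ L H).hom ≫ StarCategory.adj U
  have e : ∀ k l k' l', R.sliceAt (R.map (H ◁ a ≫ m ≫ K ◁ b)) (R.tmul K L k l)
      (R.tmul H L k' l') = ⟪l', l⟫_ℂ • R.sliceAt ((R.map (β_ K H).inv).comp T) k k' := by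
    intro k l k' l'
    ext x
    refine ext_inner_left ℂ fun y => ?_
    rw [inner_sliceAt, ← key, map_comp_apply, map_comp_apply, map_comp_apply, map_associator_inv,
      h, R.map_whiskerRight, inner_map_right (α_ K H L).hom,
      ← (MonoidalStarCategory.associator_unitary K H L).inv_eq, map_associator_inv,
      R.inner_tmul, smul_apply, inner_smul_right, inner_sliceAt, mul_comm]
    rfl
  have e1 : ∀ ξ η, R.sliceAt (R.map m) (R.map a ξ) (R.map (StarCategory.adj b) η) =
      R.sliceAt (R.map (H ◁ a ≫ m ≫ K ◁ b)) ξ η := fun ξ η => (sliceAt_whiskerLeft a m b ξ η).symm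
  apply le_antisymm
  · obtain ⟨l, hl⟩ := exists_ne (0 : R.obj L)
    refine slices_le (isClosed_slices _) fun k k' => ?_
    have h1 := sliceAt_mem_slices (R.map m) (R.map a (R.tmul K L k l))
      (R.map (StarCategory.adj b) (R.tmul H L k' l))
    rw [e1, e] at h1
    exact (Submodule.smul_mem_iff _ (inner_self_ne_zero.2 hl)).1 h1
  · refine slices_le (isClosed_slices _) fun ξ η => ?_
    have h1 : ∀ ξ η, R.sliceAt (R.map (H ◁ a ≫ m ≫ K ◁ b)) ξ η ∈
        R.slices ((R.map (β_ K H).inv).comp T) := by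
      refine sliceAt_mem_of_tmul (isClosed_slices _) fun k l k' l' => ?_
      rw [e]
      exact Submodule.smul_mem _ _ (sliceAt_mem_slices _ _ _)
    have h2 := h1 (R.map (StarCategory.adj a) ξ) (R.map b η)
    rwa [← e1, ← map_comp_apply, ha.adj_comp, map_id_apply, ← map_comp_apply, hb.comp_adj,
      map_id_apply] at h2

end Star

/-! ### Semi-regularity and regularity of `c⁻¹ (V ∗ U)` -/

section Star

open FibreFunctor

variable {C : Type u} [Category.{v} C] [MonoidalCategory C] [StarCategory C]
  {R : FibreFunctor.{w} C}

theorem FibreFunctor.adjoint_mem_slices {X Y X' Y' : C}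
    {T : R.obj (X ⊗ Y) →L[ℂ] R.obj (X' ⊗ Y')} {S : R.obj X →L[ℂ] R.obj X'} (hS : S ∈ R.slices T) :
    ContinuousLinearMap.adjoint S ∈ R.slices (ContinuousLinearMap.adjoint T) := by
  have h : R.slices T ≤ adjointComap (R.slices (ContinuousLinearMap.adjoint T)) :=
    slices_le (isClosed_adjointComap (isClosed_slices _)) fun ξ η => by
      rw [mem_adjointComap, ← sliceAt_adjoint]
      exact sliceAt_mem_slices _ _ _
  exact h hS

theorem FibreFunctor.SemiregularBraiding.compacts_le_inv {c : BraidedCategory C}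
    (h : R.SemiregularBraiding c) (H K : C) :
    R.compacts H K ≤ R.slices (R.map (c.braiding K H).inv) := by
  rw [(h.unitary K H).inv_eq, R.map_adj]
  refine compactOperator_le_of_rankOne_mem (isClosed_slices _) fun k x => ?_
  rw [← InnerProductSpace.adjoint_rankOne]
  exact adjoint_mem_slices (h.compacts_le K H (isCompactOperator_rankOne x k))

theorem FibreFunctor.RegularBraiding.slices_inv_le {c : BraidedCategory C}
    (h : R.RegularBraiding c) (H K : C) :
    R.slices (R.map (c.braiding K H).inv) ≤ R.compacts H K := by
  intro S hS
  rw [(h.unitary K H).inv_eq, R.map_adj] at hS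
  have h1 := adjoint_mem_slices hS
  rw [ContinuousLinearMap.adjoint_adjoint, ← h.compacts_eq] at h1
  have h2 := adjoint_mem_compactOperator h1
  rwa [ContinuousLinearMap.adjoint_adjoint] at h2

theorem FibreFunctor.RegularBraiding.semiregularBraiding {c : BraidedCategory C}
    (h : R.RegularBraiding c) : R.SemiregularBraiding c :=
  ⟨h.unitary, fun X Y => (h.compacts_eq X Y).le⟩

variable [BraidedCategory C] {H L K : C} {U : H ⊗ L ⟶ H ⊗ L} {V : L ⊗ K ⟶ L ⊗ K} {F : L ⊗ L ⟶ L ⊗ L}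

theorem starMorR_eq {W : H ⊗ K ⟶ H ⊗ K} (h : over13 W L = starMor U V) :
    starMorR U V = W ▷ L := by
  rw [starMorR, ← h, over13_eq]
  simp [leg12]

/-- The corepresentation equation says that `F ∗ U = U`. -/
theorem isStarOp_of_isCorep [MonoidalStarCategory C] (hF : IsUnitary F) (hU : IsUnitary U)
    (hcU : IsCorep F U) : IsStarOp R U F (R.map U) := by
  intro z l
  rw [starMorR_eq, R.map_whiskerRight]
  have h := congrArg (fun t => H ◁ StarCategory.adj F ≫ t ≫ leg12 (StarCategory.adj U) L) hcU
  simp only [Category.assoc, ← leg12_comp, hU.comp_adj, leg12_id, Category.comp_id] at h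
  rw [← MonoidalCategory.whiskerLeft_comp_assoc, hF.adj_comp, MonoidalCategory.whiskerLeft_id,
    Category.id_comp] at h
  exact h.symm

variable [MonoidalStarCategory C] [UnitarilyBraided C] [Nontrivial (R.obj L)]

/-- The multiplicativity of slices for `F ∗ U = U`. -/
theorem slices_corep (hF : IsUnitary F) (hU : IsUnitary U) (hcU : IsCorep F U) :
    R.slices (R.map (U ≫ (β_ L H).inv)) = R.slices
      (R.map (interleave (U ≫ (β_ L H).inv) (β_ L H).inv (F ≫ (β_ L L).inv))) := by
  rw [← (isStarOp_of_isCorep hF hU hcU).slices_eq hU hF, R.map_comp]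

/-- Every slice of `c⁻¹ U` multiplied by a slice of `c⁻¹ F` is a slice of `c⁻¹ U`, so the slices of
`c⁻¹ U` absorb the compact operators on `L`. -/
theorem compacts_le_slices_corep (hc : R.SemiregularBraiding inferInstance)
    (hsF : R.SemiregularMU F) (hF : IsUnitary F) (hU : IsUnitary U) (hcU : IsCorep F U) :
    R.compacts H L ≤ R.slices (R.map (U ≫ (β_ L H).inv)) := by
  have hp : IsUnitary (U ≫ (β_ L H).inv) := hU.comp (UnitarilyBraided.braiding_unitary L H).inv
  have hS := slices_corep (R := R) hF hU hcU
  set S := R.slices (R.map (U ≫ (β_ L H).inv))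
  have hScl : IsClosed (S : Set (R.obj H →L[ℂ] R.obj L)) := isClosed_slices _
  have h1 : ∀ B ∈ R.slices (R.map (F ≫ (β_ L L).inv)), ∀ l x,
      B.comp (R.sliceAt (R.map (U ≫ (β_ L H).inv)) l x) ∈ S := by
    intro B hB l x
    let P := (ContinuousLinearMap.compL ℂ (R.obj H) (R.obj L) (R.obj L)).flip
      (R.sliceAt (R.map (U ≫ (β_ L H).inv)) l x)
    have h : R.slices (R.map (F ≫ (β_ L L).inv)) ≤ S.comap P.toLinearMap := by
      refine slices_le (hScl.preimage P.continuous) fun k l' => ?_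
      change (R.sliceAt _ k l').comp (R.sliceAt _ l x) ∈ S
      rw [hS]
      exact mem_slices_interleave _ _ (hc.compacts_le_inv H L) _ _ _ _
    exact h hB
  -- the adjoints of slices of `c⁻¹ U` have dense range, so the products `|m⟩⟨z| A` with slices `A`
  -- are total among the operators `|m⟩⟨y|`
  refine compactOperator_le_of_rankOne_mem hScl fun m y => ?_
  let Q := InnerProductSpace.rankOne ℂ (F := R.obj H) m
  refine mem_of_sliceAt_mem (M := S.comap Q.toLinearMap) hp.adj (hScl.preimage Q.continuous)
    (fun x l z => ?_) y
  change InnerProductSpace.rankOne ℂ m _ ∈ S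
  rw [R.map_adj, sliceAt_adjoint, ← InnerProductSpace.rankOne_comp]
  exact h1 _ (hsF (isCompactOperator_rankOne m z)) l x

/-- For regular `c` the slices of `c⁻¹ U` are generated by multiples of slices of `c⁻¹ F`, which are
compact. -/
theorem slices_corep_le_compacts (hc : R.RegularBraiding inferInstance)
    (hrF : R.RegularMU F) (hF : IsUnitary F) (hU : IsUnitary U) (hcU : IsCorep F U) :
    R.slices (R.map (U ≫ (β_ L H).inv)) ≤ R.compacts H L := by
  rw [slices_corep hF hU hcU]
  refine slices_interleave_le _ _ (hc.slices_inv_le H L) isClosed_compactOperator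
    fun k l' l x => ?_
  have h : R.sliceAt (R.map (F ≫ (β_ L L).inv)) k l' ∈ R.compacts L L := by
    rw [hrF]
    exact sliceAt_mem_slices _ _ _
  exact IsCompactOperator.comp_clm h _

/-- The slices of `c⁻¹ (V ∗ U)` contain the products of slices of `c⁻¹ V` with slices of `c⁻¹ U`,
hence with compact operators, and the slices of the unitary `c⁻¹ V` have dense range. -/
theorem IsStarOp.compacts_le_slices (hc : R.SemiregularBraiding inferInstance)
    (hsF : R.SemiregularMU F) (hF : IsUnitary F) (hU : IsUnitary U) (hV : IsUnitary V)
    (hcU : IsCorep F U) {T : R.obj (H ⊗ K) →L[ℂ] R.obj (H ⊗ K)} (h : IsStarOp R U V T) :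
    R.compacts H K ≤ R.slices ((R.map (β_ K H).inv).comp T) := by
  have hr : IsUnitary (V ≫ (β_ K L).inv) := hV.comp (UnitarilyBraided.braiding_unitary K L).inv
  have hS := h.slices_eq hU hV
  set S := R.slices ((R.map (β_ K H).inv).comp T)
  have hScl : IsClosed (S : Set (R.obj H →L[ℂ] R.obj K)) := isClosed_slices _
  have h1 : ∀ A ∈ R.slices (R.map (U ≫ (β_ L H).inv)), ∀ k l',
      (R.sliceAt (R.map (V ≫ (β_ K L).inv)) k l').comp A ∈ S := by
    intro A hA k l'
    let P := ContinuousLinearMap.compL ℂ (R.obj H) (R.obj L) (R.obj K)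
      (R.sliceAt (R.map (V ≫ (β_ K L).inv)) k l')
    have h : R.slices (R.map (U ≫ (β_ L H).inv)) ≤ S.comap P.toLinearMap := by
      refine slices_le (hScl.preimage P.continuous) fun l x => ?_
      change (R.sliceAt _ k l').comp (R.sliceAt _ l x) ∈ S
      rw [hS]
      exact mem_slices_interleave _ _ (hc.compacts_le_inv H K) _ _ _ _
    exact h hA
  refine compactOperator_le_of_rankOne_mem hScl fun m y => ?_
  let Q := (InnerProductSpace.rankOne ℂ (E := R.obj K) (F := R.obj H)).flip y
  refine mem_of_sliceAt_mem (M := S.comap Q.toLinearMap) hr (hScl.preimage Q.continuous)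
    (fun k l' z => ?_) m
  change InnerProductSpace.rankOne ℂ _ y ∈ S
  rw [← InnerProductSpace.comp_rankOne]
  exact h1 _ (compacts_le_slices_corep hc hsF hF hU hcU (isCompactOperator_rankOne z y)) k l'

theorem IsStarOp.slices_le_compacts (hc : R.RegularBraiding inferInstance)
    (hrF : R.RegularMU F) (hF : IsUnitary F) (hU : IsUnitary U) (hV : IsUnitary V)
    (hcU : IsCorep F U) {T : R.obj (H ⊗ K) →L[ℂ] R.obj (H ⊗ K)} (h : IsStarOp R U V T) :
    R.slices ((R.map (β_ K H).inv).comp T) ≤ R.compacts H K := by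
  rw [h.slices_eq hU hV]
  refine slices_interleave_le _ _ (hc.slices_inv_le H K) isClosed_compactOperator
    fun k l' l x => ?_
  have hA : IsCompactOperator (R.sliceAt (R.map (U ≫ (β_ L H).inv)) l x) :=
    slices_corep_le_compacts hc hrF hF hU hcU (sliceAt_mem_slices _ l x)
  exact hA.clm_comp (R.sliceAt (R.map (V ≫ (β_ K L).inv)) k l')

end Star

/-! ### The braiding of the Yetter-Drinfeld category -/

section Exchange

variable {C : Type u} [Category.{v} C] [MonoidalCategory C] [BraidedCategory C] {L : C}

theorem Exchange.whiskerRight_unique {H K : C} {U : H ⊗ L ⟶ H ⊗ L} {V : L ⊗ K ⟶ L ⊗ K}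
    {W W' : H ⊗ K ⟶ H ⊗ K} [IsIso U] [IsIso V] (h : Exchange U V W) (h' : Exchange U V W') :
    W ▷ L = W' ▷ L := by
  refine whiskerRight_eq_of_over13_eq ?_
  rw [← cancel_epi (H ◁ V), ← cancel_mono (leg12 U K), Category.assoc, Category.assoc]
  exact h.symm.trans h'

theorem Exchange.natural_right {H K K' : C} {U : H ⊗ L ⟶ H ⊗ L} {V : L ⊗ K ⟶ L ⊗ K}
    {V' : L ⊗ K' ⟶ L ⊗ K'} {W : H ⊗ K ⟶ H ⊗ K} {W' : H ⊗ K' ⟶ H ⊗ K'} [IsIso U] [IsIso V]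
    (h : Exchange U V W) (h' : Exchange U V' W') {f : K ⟶ K'} (hf : V ≫ L ◁ f = L ◁ f ≫ V') :
    (H ◁ f ≫ W') ▷ L = (W ≫ H ◁ f) ▷ L := by
  have e := congrArg (fun t => H ◁ t) hf
  simp only [MonoidalCategory.whiskerLeft_comp] at e
  have n := leg12_natural U f
  unfold Exchange at h h'
  refine whiskerRight_eq_of_over13_eq ?_
  rw [over13_comp, over13_comp, over13_whiskerLeft, ← cancel_epi (H ◁ V),
    ← cancel_mono (leg12 U K')]
  simp only [Category.assoc]
  rw [reassoc_of% e, ← h', ← n, ← reassoc_of% h, ← reassoc_of% n, ← e]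

theorem Exchange.natural_left {H H' K : C} {U : H ⊗ L ⟶ H ⊗ L} {U' : H' ⊗ L ⟶ H' ⊗ L}
    {V : L ⊗ K ⟶ L ⊗ K} {W : H ⊗ K ⟶ H ⊗ K} {W' : H' ⊗ K ⟶ H' ⊗ K} [IsIso U'] [IsIso V]
    (h : Exchange U V W) (h' : Exchange U' V W') {f : H ⟶ H'} (hf : U ≫ f ▷ L = f ▷ L ≫ U') :
    (f ▷ K ≫ W') ▷ L = (W ≫ f ▷ K) ▷ L := by
  have e := congrArg (fun t => leg12 t K) hf
  simp only [leg12_comp, leg12_whiskerRight] at e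
  unfold Exchange at h h'
  refine whiskerRight_eq_of_over13_eq ?_
  rw [over13_comp, over13_comp, over13_whiskerRight, ← cancel_epi (H ◁ V),
    ← cancel_mono (leg12 U' K)]
  simp only [Category.assoc]
  rw [whisker_exchange_assoc, ← h', ← e, ← reassoc_of% h, whisker_exchange, reassoc_of% e]

/-- The relation of `Exchange.comm_corep` says that `c⁻¹ W` intertwines the corepresentations. -/
theorem braiding_comm_corep {H K : C} {U : H ⊗ L ⟶ H ⊗ L} {U' : K ⊗ L ⟶ K ⊗ L}
    {W : H ⊗ K ⟶ H ⊗ K}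
    (h : H ◁ U' ≫ over13 U K ≫ leg12 W L = leg12 W L ≫ under13 U K ≫ H ◁ U') :
    tensorCorep U U' ≫ (W ≫ (β_ K H).inv) ▷ L =
      (W ≫ (β_ K H).inv) ▷ L ≫ tensorCorep U' U := by
  have e : (W ≫ (β_ K H).inv) ▷ L =
      (α_ H K L).hom ≫ leg12 W L ≫ leg12 (β_ K H).inv L ≫ (α_ K H L).inv := by
    simp [leg12]
  rw [e, tensorCorep, tensorCorep]
  simp only [Category.assoc, Iso.inv_hom_id_assoc]
  rw [reassoc_of% h, over13, under13]
  simp only [Category.assoc]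

/-- The relation of `Exchange.comm_rep` says that `c⁻¹ W` intertwines the representations. -/
theorem braiding_comm_rep {H K : C} {V : L ⊗ K ⟶ L ⊗ K} {V' : L ⊗ H ⟶ L ⊗ H}
    {W : H ⊗ K ⟶ H ⊗ K}
    (h : leg12 V' K ≫ under13 V H ≫ L ◁ W = L ◁ W ≫ over13 V H ≫ leg12 V' K) :
    tensorRep V' V ≫ L ◁ (W ≫ (β_ K H).inv) = L ◁ (W ≫ (β_ K H).inv) ≫ tensorRep V V' := by
  rw [tensorRep, tensorRep, MonoidalCategory.whiskerLeft_comp, Category.assoc, reassoc_of% h,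
    over13_eq, under13_eq]
  simp

/-- The hexagon for `c⁻¹ W` when `W` on `(A ⊗ B) ⊗ K` is given by `Exchange.tensor_left`. -/
theorem hexagon_left {A B K : C} (W₁ : A ⊗ K ⟶ A ⊗ K) (W₂ : B ⊗ K ⟶ B ⊗ K) :
    (α_ A B K).inv ≫ (((α_ A B K).hom ≫ A ◁ W₂ ≫ over13 W₁ B ≫ (α_ A B K).inv) ≫
        (β_ K (A ⊗ B)).inv) ≫ (α_ K A B).inv =
      A ◁ (W₂ ≫ (β_ K B).inv) ≫ (α_ A K B).inv ≫ (W₁ ≫ (β_ K A).inv) ▷ B := by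
  rw [over13_eq]
  simp [leg12]

/-- The hexagon for `c⁻¹ W` when `W` on `H ⊗ (A ⊗ B)` is given by `Exchange.tensor_right`. -/
theorem hexagon_right {H A B : C} (W₁ : H ⊗ A ⟶ H ⊗ A) (W₂ : H ⊗ B ⟶ H ⊗ B) :
    (α_ H A B).hom ≫ ((leg12 W₁ B ≫ under13 W₂ A) ≫ (β_ (A ⊗ B) H).inv) ≫ (α_ A B H).hom =
      (W₁ ≫ (β_ A H).inv) ▷ B ≫ (α_ A H B).hom ≫ A ◁ (W₂ ≫ (β_ B H).inv) := by
  rw [under13]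
  simp [leg12]

end Exchange

section Unitary

variable {C : Type u} [Category.{v} C] [StarCategory C]

theorem IsUnitary.isIso {X Y : C} {f : X ⟶ Y} (hf : IsUnitary f) : IsIso f :=
  ⟨StarCategory.adj f, hf.comp_adj, hf.adj_comp⟩

variable [MonoidalCategory C] [BraidedCategory C]

theorem exchange_iff {H K L : C} {U : H ⊗ L ⟶ H ⊗ L} {V : L ⊗ K ⟶ L ⊗ K} {W : H ⊗ K ⟶ H ⊗ K}
    (hU : IsUnitary U) (hV : IsUnitary V) : Exchange U V W ↔ over13 W L = starMor U V := by
  have := hU.isIso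
  have := hV.isIso
  have e₁ : H ◁ V ≫ H ◁ StarCategory.adj V = 𝟙 _ := by
    rw [← MonoidalCategory.whiskerLeft_comp, hV.comp_adj, MonoidalCategory.whiskerLeft_id]
  have e₂ : leg12 (StarCategory.adj U) K ≫ leg12 U K = 𝟙 _ := by
    rw [← leg12_comp, hU.adj_comp, leg12_id]
  rw [← cancel_epi (H ◁ V), ← cancel_mono (leg12 U K), Exchange, starMor]
  simp only [Category.assoc, reassoc_of% e₁, e₂, Category.comp_id]
  exact eq_comm

end Unitary

namespace YD

variable {C : Type u} [Category.{v} C] [StarCategory C] [MonoidalCategory C] [BraidedCategory C]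
  {L : C} {F : L ⊗ L ⟶ L ⊗ L}

theorem isStarProduct_iff {X Y : YD F} {W : X.obj ⊗ Y.obj ⟶ X.obj ⊗ Y.obj} :
    IsStarProduct X Y W ↔ Exchange X.U Y.V W :=
  (exchange_iff X.unitary_U Y.unitary_V).symm

variable [MonoidalStarCategory C] [UnitarilyBraided C]

/-- Unitaries `W_{X,Y} = V_Y ∗ U_X` give a braiding `c⁻¹ W` on the Yetter-Drinfeld category, if
morphisms can be tested after tensoring with `L`. -/
@[reducible]
def braidedOfExchange (hF : IsUnitary F)
    (hL : ∀ {X Y : C} (f g : X ⟶ Y), f ▷ L = g ▷ L → f = g)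
    (W : ∀ X Y : YD F, X.obj ⊗ Y.obj ⟶ X.obj ⊗ Y.obj) (hW : ∀ X Y, IsUnitary (W X Y))
    (h : ∀ X Y : YD F, Exchange X.U Y.V (W X Y)) : BraidedCategory (YD F) :=
  have := hF.isIso
  have hUi : ∀ X : YD F, IsIso X.U := fun X => X.unitary_U.isIso
  have hVi : ∀ X : YD F, IsIso X.V := fun X => X.unitary_V.isIso
  { braiding := fun X Y =>
      isoMk (X := X ⊗ Y) (Y := Y ⊗ X)
        (@asIso _ _ _ _ (W X Y) (hW X Y).isIso ≪≫ (β_ Y.obj X.obj).symm)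
        (braiding_comm_corep (hL _ _ ((h X Y).comm_corep X.isCorep Y.isYD)))
        (braiding_comm_rep (hL _ _ ((h X Y).comm_rep Y.isRep X.isYD)))
    braiding_naturality_right := fun X Y Z f => Hom.ext (by
      have e := hL _ _ ((h X Y).natural_right (h X Z) f.comm_V)
      change X.obj ◁ f.hom ≫ W X Z ≫ (β_ Z.obj X.obj).inv =
        (W X Y ≫ (β_ Y.obj X.obj).inv) ≫ f.hom ▷ X.obj
      rw [reassoc_of% e, Category.assoc, BraidedCategory.braiding_inv_naturality_right])
    braiding_naturality_left := fun {X Y} f Z => Hom.ext (by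
      have e := hL _ _ ((h X Z).natural_left (h Y Z) f.comm_U)
      change f.hom ▷ Z.obj ≫ W Y Z ≫ (β_ Z.obj Y.obj).inv =
        (W X Z ≫ (β_ Z.obj X.obj).inv) ≫ Z.obj ◁ f.hom
      rw [reassoc_of% e, Category.assoc, BraidedCategory.braiding_inv_naturality_left])
    hexagon_forward := fun X Y Z => Hom.ext (by
      have := hVi (Y ⊗ Z)
      have e := hL _ _ ((h X (Y ⊗ Z)).whiskerRight_unique ((h X Y).tensor_right (h X Z)))
      change (α_ X.obj Y.obj Z.obj).hom ≫ (W X (Y ⊗ Z) ≫ (β_ (Y.obj ⊗ Z.obj) X.obj).inv) ≫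
          (α_ Y.obj Z.obj X.obj).hom = (W X Y ≫ (β_ Y.obj X.obj).inv) ▷ Z.obj ≫
            (α_ Y.obj X.obj Z.obj).hom ≫ Y.obj ◁ (W X Z ≫ (β_ Z.obj X.obj).inv)
      rw [← hexagon_right, e]
      rfl)
    hexagon_reverse := fun X Y Z => Hom.ext (by
      have := hUi (X ⊗ Y)
      have e := hL _ _ ((h (X ⊗ Y) Z).whiskerRight_unique ((h X Z).tensor_left (h Y Z)))
      change (α_ X.obj Y.obj Z.obj).inv ≫ (W (X ⊗ Y) Z ≫ (β_ Z.obj (X.obj ⊗ Y.obj)).inv) ≫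
          (α_ Z.obj X.obj Y.obj).inv = X.obj ◁ (W Y Z ≫ (β_ Z.obj Y.obj).inv) ≫
            (α_ X.obj Z.obj Y.obj).inv ≫ (W X Z ≫ (β_ Z.obj X.obj).inv) ▷ Y.obj
      rw [← hexagon_left, e]
      rfl) }

/-- A Yetter-Drinfeld braiding is determined by its defining formula. -/
theorem IsYDBraiding.unique (hL : ∀ {X Y : C} (f g : X ⟶ Y), f ▷ L = g ▷ L → f = g)
    {Φ Φ' : BraidedCategory (YD F)} (h : IsYDBraiding Φ) (h' : IsYDBraiding Φ') : Φ = Φ' := by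
  have e : Φ.braiding = Φ'.braiding := by
    funext X Y
    obtain ⟨W, -, hW, e⟩ := h X Y
    obtain ⟨W', -, hW', e'⟩ := h' X Y
    have := X.unitary_U.isIso
    have := Y.unitary_V.isIso
    rw [isStarProduct_iff] at hW hW'
    refine Iso.ext (Hom.ext ?_)
    rw [e, e', hL _ _ (hW.whiskerRight_unique hW')]
  cases Φ
  cases Φ'
  cases e
  rfl

theorem IsYDBraiding.isUnitary {Φ : BraidedCategory (YD F)} (h : IsYDBraiding Φ) (X Y : YD F) :
    IsUnitary (Φ.braiding X Y).hom := by
  obtain ⟨W, hW, -, e⟩ := h X Y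
  have hu := hW.comp (UnitarilyBraided.braiding_unitary Y.obj X.obj).inv
  rw [← e] at hu
  exact ⟨Hom.ext hu.comp_adj, Hom.ext hu.adj_comp⟩

theorem IsYDBraiding.exists_isStarOperator (R : FibreFunctor.{w} C) {Φ : BraidedCategory (YD F)}
    (h : IsYDBraiding Φ) (X Y : YD F) : ∃ T, IsStarOperator R X Y T ∧
      (fibre R F).map (Φ.braiding X Y).hom = braidOperator R X Y T := by
  obtain ⟨W, -, hW, e⟩ := h X Y
  refine ⟨R.map W, hW.isStarOperator R, ?_⟩
  exact (congrArg R.map e).trans (R.map_comp W _)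

/-- If the fibre functor is faithful, equations between morphisms of `C` can be tested on Hilbert
spaces, and there after tensoring with the nonzero space of `L`. -/
theorem existsUnique_isYDBraiding {R : FibreFunctor.{w} C} [Nontrivial (R.obj L)]
    (hR : R.IsFaithful) (hF : IsUnitary F)
    (h : ∀ X Y : YD F, ∃ W : X.obj ⊗ Y.obj ⟶ X.obj ⊗ Y.obj, IsStarOperator R X Y (R.map W)) :
    ∃! Φ : BraidedCategory (YD F), IsYDBraiding Φ := by
  obtain ⟨l, hl⟩ := exists_ne (0 : R.obj L)
  have hL : ∀ {X Y : C} (f g : X ⟶ Y), f ▷ L = g ▷ L → f = g := by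
    intro X Y f g hfg
    refine hR _ _ _ _ ?_
    ext x
    refine FibreFunctor.tmul_right_injective hl ?_
    change R.tmul Y L (R.map f x) l = R.tmul Y L (R.map g x) l
    rw [← R.map_whiskerRight, hfg, R.map_whiskerRight]
  choose W hW using h
  have hu : ∀ X Y, IsUnitary (W X Y) := by
    intro X Y
    have h1 := Unitary.mem_iff.1
      (IsStarOp.mem_unitary (U := X.U) (V := Y.V) (hW X Y) X.unitary_U Y.unitary_V)
    rw [ContinuousLinearMap.star_eq_adjoint, ← R.map_adj] at h1
    constructor <;> refine hR _ _ _ _ ?_ <;> rw [R.map_comp, R.map_id]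
    exacts [h1.1, h1.2]
  have hx : ∀ X Y : YD F, IsStarProduct X Y (W X Y) := by
    intro X Y
    have h1 : starMorR X.U Y.V = W X Y ▷ L := by
      refine hR _ _ _ _ (FibreFunctor.tmul_ext fun z l => ?_)
      rw [R.map_whiskerRight]
      exact hW X Y z l
    have h2 : over13 (W X Y) L =
        X.obj ◁ (β_ Y.obj L).inv ≫ (α_ _ _ _).inv ≫ starMorR X.U Y.V ≫ (α_ _ _ _).hom ≫
          X.obj ◁ (β_ Y.obj L).hom := by
      rw [h1, over13_eq]
      simp [leg12]
    refine h2.trans ?_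
    simp only [starMorR, Category.assoc, Iso.inv_hom_id_assoc, whiskerLeft_inv_hom,
      whiskerLeft_inv_hom_assoc, Category.comp_id]
    rfl
  refine ⟨braidedOfExchange hF hL W hu fun X Y => isStarProduct_iff.1 (hx X Y),
    fun X Y => ⟨W X Y, hu X Y, hx X Y, rfl⟩, fun Φ hΦ => hΦ.unique hL ?_⟩
  exact fun X Y => ⟨W X Y, hu X Y, hx X Y, rfl⟩

end YD

end

end BraidedMU

open CategoryTheory MonoidalCategory BraidedMU in
theorem mainTheorem3 {C : Type u} [Category.{v} C] [WStarCategory C] [MonoidalCategory C]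
    [MonoidalWStarCategory C] [BraidedCategory C] [UnitarilyBraided C]
    (R : FibreFunctor.{w} C) (hR : R.IsNormal)
    {L : C} [Nontrivial (R.obj L)] (F : L ⊗ L ⟶ L ⊗ L) (hF : IsMultiplicativeUnitary F) :
    (R.SemiregularBraiding inferInstance → R.SemiregularMU F →
      (∀ X Y : YD F, ∃! T : R.obj (X.obj ⊗ Y.obj) →L[ℂ] R.obj (X.obj ⊗ Y.obj),
        YD.IsStarOperator R X Y T) ∧
      (∀ (X Y : YD F) (T : R.obj (X.obj ⊗ Y.obj) →L[ℂ] R.obj (X.obj ⊗ Y.obj)),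
        YD.IsStarOperator R X Y T →
          T ∈ unitary (R.obj (X.obj ⊗ Y.obj) →L[ℂ] R.obj (X.obj ⊗ Y.obj)) ∧
          R.compacts X.obj Y.obj ≤ R.slices (YD.braidOperator R X Y T)) ∧
      (R.IsFaithful →
        (∀ (X Y : YD F) (T : R.obj (X.obj ⊗ Y.obj) →L[ℂ] R.obj (X.obj ⊗ Y.obj)),
          YD.IsStarOperator R X Y T → ∃ W : X.obj ⊗ Y.obj ⟶ X.obj ⊗ Y.obj, R.map W = T) →
        ∃! Φ : BraidedCategory (YD F), YD.IsYDBraiding Φ) ∧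
      (∀ Φ : BraidedCategory (YD F), YD.IsYDBraiding Φ →
        (YD.fibre R F).SemiregularBraiding Φ)) ∧
    (R.RegularBraiding inferInstance → R.RegularMU F →
      (∀ (X Y : YD F) (T : R.obj (X.obj ⊗ Y.obj) →L[ℂ] R.obj (X.obj ⊗ Y.obj)),
        YD.IsStarOperator R X Y T →
          R.compacts X.obj Y.obj = R.slices (YD.braidOperator R X Y T)) ∧
      (∀ Φ : BraidedCategory (YD F), YD.IsYDBraiding Φ →
        (YD.fibre R F).RegularBraiding Φ)) := by
  have hc {Φ : BraidedCategory (YD F)} (hs : R.SemiregularBraiding inferInstance)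
      (hsF : R.SemiregularMU F) (hΦ : YD.IsYDBraiding Φ) :
      (YD.fibre R F).SemiregularBraiding Φ := by
    refine ⟨hΦ.isUnitary, fun X Y => ?_⟩
    obtain ⟨T, hT, e⟩ := hΦ.exists_isStarOperator R X Y
    rw [e]
    exact IsStarOp.compacts_le_slices (U := X.U) (V := Y.V) hs hsF hF.unitary X.unitary_U
      Y.unitary_V X.isCorep hT
  have hr (hs : R.RegularBraiding inferInstance) (hsF : R.RegularMU F) (X Y : YD F)
      (T : R.obj (X.obj ⊗ Y.obj) →L[ℂ] R.obj (X.obj ⊗ Y.obj)) (hT : YD.IsStarOperator R X Y T) :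
      R.compacts X.obj Y.obj = R.slices (YD.braidOperator R X Y T) :=
    le_antisymm
      (IsStarOp.compacts_le_slices (U := X.U) (V := Y.V) hs.semiregularBraiding hsF.le hF.unitary
        X.unitary_U Y.unitary_V X.isCorep hT)
      (IsStarOp.slices_le_compacts (U := X.U) (V := Y.V) hs hsF hF.unitary X.unitary_U
        Y.unitary_V X.isCorep hT)
  refine ⟨fun hs hsF => ⟨fun X Y => ?_, fun X Y T hT => ⟨?_, ?_⟩, fun hfaith h => ?_,
    fun Φ hΦ => hc hs hsF hΦ⟩, fun hs hsF => ⟨hr hs hsF, fun Φ hΦ => ⟨hΦ.isUnitary, fun X Y => ?_⟩⟩⟩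
  · obtain ⟨T, hT⟩ := exists_isStarOp (R := R) X.unitary_U Y.unitary_V X.isCorep Y.isRep hsF
    exact ⟨T, hT, fun T' hT' => IsStarOp.unique (U := X.U) (V := Y.V) hT' hT⟩
  · exact IsStarOp.mem_unitary (U := X.U) (V := Y.V) hT X.unitary_U Y.unitary_V
  · exact IsStarOp.compacts_le_slices (U := X.U) (V := Y.V) hs hsF hF.unitary X.unitary_U
      Y.unitary_V X.isCorep hT
  · refine YD.existsUnique_isYDBraiding hfaith hF.unitary fun X Y => ?_
    obtain ⟨T, hT⟩ := exists_isStarOp (R := R) X.unitary_U Y.unitary_V X.isCorep Y.isRep hsF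
    obtain ⟨W, rfl⟩ := h X Y T hT
    exact ⟨W, hT⟩
  · obtain ⟨T, hT, e⟩ := hΦ.exists_isStarOperator R X Y
    rw [e]
    exact hr hs hsF X Y T hT
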